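/- Let $n\ge 1$, $0<d<n$ and $p\in[1,\infty)$, and let $p'\in(1,\infty]$ be the conjugate exponent of $p$. Let $\mathcal D$ be the family of dyadic cubes $Q=2^{-k}(j+[0,1)^n)$, $k\in\mathbb Z$, $j\in\mathbb Z^n$, with side length $\ell(Q)=2^{-k}$, and let $$H^d(E)=\inf\Big\{\sum_j\ell(Q_j)^d:\ E\subset\bigcup_jQ_j,\ Q_j\in\mathcal D\Big\}$$ (countable coverings) be the dyadic Hausdorff content of $E\subset\mathbb R^n$. For $F:\mathbb R^n\to[0,\infty]$ put $$\|F\|_{\mathcal L^q(H^d)}=\Big(\int_0^\infty H^d(\{F^q>t\})\,dt\Big)^{1/q}\quad(0<q<\infty),\qquad \|F\|_{\mathcal L^\infty(H^d)}=\inf\{t>0:\ H^d(\{F>t\})=0\}.$$ Let $\Phi:[0,\infty)\to[0,\infty]$ be a Young function (left-continuous, convex, nondecreasing, $\Phi(0)=0$, $\Phi(t)\to\infty$ as $t\to\infty$) satisfying the $\Delta_2$-condition: $\Phi(2t)\le K\Phi(t)$ for all $t>0$ and some $K>1$. Let $\overline\Phi(t)=\sup_{s\ge 0}(ts-\Phi(s))$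 be its complementary function. For $\Psi\in\{\Phi,\overline\Phi\}$, a cube $Q\in\mathcal D$ and a measurable function $f$ on $\mathbb R^n$ let $$\|f\|_{\Psi;Q}=\inf\Big\{\lambda>0:\ \frac1{|Q|}\int_Q\Psi\Big(\frac{|f(x)|}{\lambda}\Big)dx\le1\Big\}.$$ A tiling is a family $\mathcal T\subset\mathcal D$ such that every point of $\mathbb R^n$ lies in exactly one $Q\in\mathcal T$. Define, with values in $[0,\infty]$, $$\|g\|_{\mathcal M^{p'}_{\overline\Phi}(H^d)}=\Big\|\sup_{Q\in\mathcal D}\ell(Q)^{n-d}\|g\|_{\overline\Phi;Q}\mathbf 1_Q\Big\|_{\mathcal L^{p'}(H^d)},\qquad \|f\|_{\mathcal B^p_\Phi(H^d,\mathcal T)}=\Big\|\sum_{Q\in\mathcal T}\|f\|_{\Phi;Q}^p\mathbf 1_Q\Big\|_{\mathcal L^1(H^d)}^{1/p},$$ $$\|g\|_{\mathcal M^{p'}_{\overline\Phi}(H^d,\mathcal T)}=\Big\|\sum_{Q\in\mathcal T}\big(\ell(Q)^{n-d}\|g\|_{\overline\Phi;Q}\big)^{p'}\mathbf 1_Q\Big\|_{\mathcal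 L^1(H^d)}^{1/p'},$$ where for $p'=\infty$ (that is, $p=1$) the last quantity is read as $\big\|\sum_{Q\in\mathcal T}\ell(Q)^{n-d}\|g\|_{\overline\Phi;Q}\mathbf 1_Q\big\|_{\mathcal L^\infty(H^d)}$. For each of the two Orlicz–Morrey spaces $X$ above the associate norm is $$\|f\|_{X'}=\sup\Big\{\int_{\mathbb R^n}|f(x)g(x)|\,dx:\ g\text{ measurable},\ \|g\|_X\le1\Big\}.$$ **Theorem.** There is a finite constant $C$, depending only on $n,d,p$ and $\Phi$, such that for every tiling $\mathcal T$ of $\mathbb R^n$ and every measurable function $f:\mathbb R^n\to\mathbb R$ $$\|f\|_{\mathcal M^{p'}_{\overline\Phi}(H^d)'}\le C\,\|f\|_{\mathcal B^p_\Phi(H^d,\mathcal T)}\qquad\text{and}\qquad \|f\|_{\mathcal B^p_\Phi(H^d,\mathcal T)}\le C\,\|f\|_{\mathcal M^{p'}_{\overline\Phi}(H^d,\mathcal T)'}.$$ (All quantities may be $+\infty$.) -/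

import Mathlib

open MeasureTheory Filter Topology
open scoped NNReal ENNReal

noncomputable section

namespace ChoquetMorrey

/-! ### Dyadic cubes and the dyadic Hausdorff content -/

/-- Index of the dyadic cube `2^(-k) (j + [0,1)^n)`. (For `n ≥ 1` different indices give different
cubes.) -/
structure DyadicCube (n : ℕ) where
  /-- the generation of the cube -/
  k : ℤ
  /-- the position of the cube -/
  j : Fin n → ℤ

namespace DyadicCube

variable {n : ℕ}

/-- The side length `ℓ(Q) = 2^(-k)`. -/
def side (Q : DyadicCube n) : ℝ≥0 := (2 : ℝ≥0) ^ (-Q.k)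

/-- The half-open cube `2^(-k) (j + [0,1)^n)` as a set of points of `ℝⁿ`. -/
def toSet (Q : DyadicCube n) : Set (Fin n → ℝ) :=
  {x | ∀ i, (Q.side : ℝ) * (Q.j i : ℝ) ≤ x i ∧ x i < (Q.side : ℝ) * ((Q.j i : ℝ) + 1)}

end DyadicCube

/-- The `d`-dimensional dyadic Hausdorff content of a set `E ⊆ ℝⁿ`: the infimum of `∑ ℓ(Q)^d` over
all families of dyadic cubes that cover `E`. (There are only countably many dyadic cubes.) -/
def hausdorffContent {n : ℕ} (d : ℝ) (E : Set (Fin n → ℝ)) : ℝ≥0∞ :=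
  ⨅ (𝒞 : Set (DyadicCube n)) (_ : E ⊆ ⋃ Q ∈ 𝒞, Q.toSet),
    ∑' Q : 𝒞, ((Q : DyadicCube n).side : ℝ≥0∞) ^ d

/-- The Choquet integral `∫ F dH^d = ∫_0^∞ H^d({F > t}) dt` of a function `F ≥ 0`. -/
def choquetIntegral {n : ℕ} (d : ℝ) (F : (Fin n → ℝ) → ℝ≥0∞) : ℝ≥0∞ :=
  ∫⁻ t in Set.Ioi (0 : ℝ), hausdorffContent d {x | ENNReal.ofReal t < F x}

/-- The functional `‖F‖_{L^q(H^d)}` of a function `F ≥ 0`, for `0 < q ≤ ∞`: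
`(∫ F^q dH^d)^(1/q)` if `q < ∞`, and `inf {t > 0 : H^d({F > t}) = 0}` if `q = ∞`. -/
def choquetNorm {n : ℕ} (d : ℝ) (q : ℝ≥0∞) (F : (Fin n → ℝ) → ℝ≥0∞) : ℝ≥0∞ :=
  open Classical in
  if q = ∞ then
    ⨅ (t : ℝ≥0) (_ : 0 < t) (_ : hausdorffContent d {x | (t : ℝ≥0∞) < F x} = 0), (t : ℝ≥0∞)
  else
    choquetIntegral d (fun x => F x ^ q.toReal) ^ (q.toReal)⁻¹

/-! ### Young functions -/

/-- Young functions `Φ : [0,∞) → [0,∞]`. -/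
structure IsYoung (Φ : ℝ≥0 → ℝ≥0∞) : Prop where
  leftContinuous : ∀ t, ContinuousWithinAt Φ (Set.Iic t) t
  convex : ConvexOn ℝ≥0 Set.univ Φ
  monotone : Monotone Φ
  map_zero : Φ 0 = 0
  tendsto_top : Tendsto Φ atTop (𝓝 ∞)

/-- The `Δ₂`-condition. -/
def Delta2 (Φ : ℝ≥0 → ℝ≥0∞) : Prop :=
  ∃ K : ℝ≥0, 1 < K ∧ ∀ t : ℝ≥0, 0 < t → Φ (2 * t) ≤ K * Φ t

/-- The complementary function `sup_{s ≥ 0} (t s - Φ(s))`. (The term `s = 0` makes the supremum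
nonnegative when `Φ 0 = 0`, so truncating the difference at `0` does not change it.) -/
def complementary (Φ : ℝ≥0 → ℝ≥0∞) (t : ℝ≥0) : ℝ≥0∞ :=
  ⨆ s : ℝ≥0, ((t : ℝ≥0∞) * s - Φ s)

/-- The `Φ`-average `inf {l > 0 : ⨍_Q Φ(|f|/l) dx ≤ 1}` over the cube `Q` (`∞` if there is no
such `l`). -/
def luxemburg {n : ℕ} (Φ : ℝ≥0 → ℝ≥0∞) (Q : DyadicCube n) (f : (Fin n → ℝ) → ℝ) : ℝ≥0∞ :=
  ⨅ (l : ℝ≥0) (_ : 0 < l) (_ : ⨍⁻ x in Q.toSet, Φ (‖f x‖₊ / l) ∂volume ≤ 1), (l : ℝ≥0∞)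

/-! ### Orlicz-Morrey and Orlicz block functionals -/

/-- The dyadic fractional Orlicz maximal operator
`M_{α,Φ} f (x) = sup_Q ℓ(Q)^α ‖f‖_{Φ;Q} 1_Q(x)`. -/
def maximal {n : ℕ} (α : ℝ) (Φ : ℝ≥0 → ℝ≥0∞) (f : (Fin n → ℝ) → ℝ) (x : Fin n → ℝ) : ℝ≥0∞ :=
  ⨆ Q : DyadicCube n, Q.toSet.indicator (fun _ => (Q.side : ℝ≥0∞) ^ α * luxemburg Φ Q f) x

/-- The Orlicz-Morrey norm `‖g‖_{M^q_Φ(H^d)} = ‖M_{n-d,Φ} g‖_{L^q(H^d)}`. -/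
def morreyNorm {n : ℕ} (d : ℝ) (q : ℝ≥0∞) (Φ : ℝ≥0 → ℝ≥0∞) (g : (Fin n → ℝ) → ℝ) : ℝ≥0∞ :=
  choquetNorm d q (maximal ((n : ℝ) - d) Φ g)

/-- A tiling of `ℝⁿ`: a family of dyadic cubes such that every point lies in exactly one of them,
that is, `∑_{Q ∈ 𝒯} 1_Q = 1` everywhere. -/
def IsTiling {n : ℕ} (𝒯 : Set (DyadicCube n)) : Prop :=
  ∀ x : Fin n → ℝ, ∃! Q : DyadicCube n, Q ∈ 𝒯 ∧ x ∈ Q.toSet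

/-- The function `∑_{Q ∈ 𝒯} a_Q 1_Q`. -/
def tileSum {n : ℕ} (𝒯 : Set (DyadicCube n)) (a : DyadicCube n → ℝ≥0∞) (x : Fin n → ℝ) : ℝ≥0∞ :=
  ∑' Q : 𝒯, (Q : DyadicCube n).toSet.indicator (fun _ => a Q) x

/-- The Orlicz block norm
`‖f‖_{B^p_Φ(H^d,𝒯)} = ‖∑_{Q ∈ 𝒯} ‖f‖_{Φ;Q}^p 1_Q‖_{L^1(H^d)}^(1/p)`, for `1 ≤ p < ∞`. -/
def blockNorm {n : ℕ} (d : ℝ) (p : ℝ≥0∞) (Φ : ℝ≥0 → ℝ≥0∞) (𝒯 : Set (DyadicCube n))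
    (f : (Fin n → ℝ) → ℝ) : ℝ≥0∞ :=
  choquetNorm d 1 (tileSum 𝒯 fun Q => luxemburg Φ Q f ^ p.toReal) ^ (p.toReal)⁻¹

/-- The Orlicz-Morrey norm of a tiling,
`‖g‖_{M^q_Φ(H^d,𝒯)} = ‖∑_{Q ∈ 𝒯} (ℓ(Q)^(n-d) ‖g‖_{Φ;Q})^q 1_Q‖_{L^1(H^d)}^(1/q)` for `q < ∞`, with
the usual modification `‖∑_{Q ∈ 𝒯} ℓ(Q)^(n-d) ‖g‖_{Φ;Q} 1_Q‖_{L^∞(H^d)}` for `q = ∞`. -/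
def tilingMorreyNorm {n : ℕ} (d : ℝ) (q : ℝ≥0∞) (Φ : ℝ≥0 → ℝ≥0∞) (𝒯 : Set (DyadicCube n))
    (g : (Fin n → ℝ) → ℝ) : ℝ≥0∞ :=
  open Classical in
  if q = ∞ then
    choquetNorm d ∞ (tileSum 𝒯 fun Q => (Q.side : ℝ≥0∞) ^ ((n : ℝ) - d) * luxemburg Φ Q g)
  else
    choquetNorm d 1
      (tileSum 𝒯 fun Q => ((Q.side : ℝ≥0∞) ^ ((n : ℝ) - d) * luxemburg Φ Q g) ^ q.toReal)
        ^ (q.toReal)⁻¹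

/-- The associate norm `‖f‖_{X'} = sup {∫ |f g| dx : ‖g‖_X ≤ 1}`, the supremum being over Lebesgue
measurable functions `g`. -/
def associateNorm {n : ℕ} (ρ : ((Fin n → ℝ) → ℝ) → ℝ≥0∞) (f : (Fin n → ℝ) → ℝ) : ℝ≥0∞ :=
  ⨆ (g : (Fin n → ℝ) → ℝ) (_ : AEMeasurable g volume) (_ : ρ g ≤ 1), ∫⁻ x, ‖f x * g x‖ₑ

end ChoquetMorrey

end

noncomputable section

namespace ChoquetMorrey

/-! ### Dyadic cubes -/

namespace DyadicCube

variable {n : ℕ}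

/-! Write `a_Q = ‖f‖_{Φ;Q}` and `b_Q = ℓ(Q)^(n-d) ‖g‖_{Φ̄;Q}`. Since `|Q| = ℓ(Q)^d ℓ(Q)^(n-d)`,
local Orlicz duality turns `∫|fg|` into the discrete pairing `∑_{Q ∈ 𝒯} ℓ(Q)^d a_Q b_Q`, and both
inequalities compare such sums with Choquet integrals of tile functions.

The comparison `∫ ∑ a_Q 1_Q dH^d ≤ ∑ ℓ(Q)^d a_Q` always holds (`choquetIntegral_tileSum_le`). It
gives the second inequality: the block norm is at most a weighted `ℓ^p` norm of `(a_Q)`, the tiling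
Morrey norm is at most the dual `ℓ^{p'}` norm of `(b_Q)`, and near-extremal functions on single
tiles are glued with extremal `ℓ^{p'}` coefficients (`exists_dual_of_lt_luxemburg`,
`sum_le_associateNorm`).

The first inequality needs the opposite comparison, which fails in general because many small tiles
may have a union of small content. It is rescued by the packing condition `∑_{Q ⊆ R} ℓ(Q)^d b_Q ≤ 2
ℓ(R)^d b_R` (`tsum_volume_mul_luxemburg_le`). Cover a level set by dyadic cubes. The tiles inside a
covering cube are controlled by packing; any other tile is charged to the smaller covering cubes
inside it. Summing over dyadic levels gives a Carleson embedding
(`tsum_le_choquetIntegral_of_carleson`), in which the maximal function enters because it dominates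
`b_R` for every dyadic `R`, tile or not.

The `Δ₂`-condition enters only through a dichotomy: `Φ` is finite everywhere, or infinite off the
origin. -/

lemma side_pos (Q : DyadicCube n) : 0 < Q.side := zpow_pos two_pos _

lemma coe_side_ne_zero (Q : DyadicCube n) : (Q.side : ℝ≥0∞) ≠ 0 := by
  simpa using Q.side_pos.ne'

lemma side_rpow_ne_zero (Q : DyadicCube n) (d : ℝ) : (Q.side : ℝ≥0∞) ^ d ≠ 0 := by
  rw [← ENNReal.coe_rpow_of_ne_zero Q.side_pos.ne']
  simpa using (NNReal.rpow_pos Q.side_pos).ne'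

lemma side_rpow_ne_top (Q : DyadicCube n) (d : ℝ) : (Q.side : ℝ≥0∞) ^ d ≠ ∞ := by
  rw [← ENNReal.coe_rpow_of_ne_zero Q.side_pos.ne']
  exact ENNReal.coe_ne_top

lemma side_rpow_add (Q : DyadicCube n) (s t : ℝ) :
    (Q.side : ℝ≥0∞) ^ (s + t) = (Q.side : ℝ≥0∞) ^ s * (Q.side : ℝ≥0∞) ^ t :=
  ENNReal.rpow_add _ _ Q.coe_side_ne_zero ENNReal.coe_ne_top

instance : Countable (DyadicCube n) := by
  have : Function.Injective fun Q : DyadicCube n => (Q.k, Q.j) := by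
    rintro ⟨k, j⟩ ⟨k', j'⟩ h
    simpa using h
  exact this.countable

lemma toSet_eq_pi (Q : DyadicCube n) :
    Q.toSet = Set.univ.pi fun i =>
      Set.Ico ((Q.side : ℝ) * (Q.j i : ℝ)) ((Q.side : ℝ) * ((Q.j i : ℝ) + 1)) := by
  ext x
  simp [toSet]

lemma measurableSet_toSet (Q : DyadicCube n) : MeasurableSet Q.toSet := by
  rw [toSet_eq_pi]
  exact MeasurableSet.univ_pi fun _ => measurableSet_Ico

lemma volume_toSet (Q : DyadicCube n) : volume Q.toSet = (Q.side : ℝ≥0∞) ^ (n : ℝ) := by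
  rw [toSet_eq_pi, Real.volume_pi_Ico]
  have : ∀ i, (Q.side : ℝ) * ((Q.j i : ℝ) + 1) - (Q.side : ℝ) * (Q.j i : ℝ) = Q.side := by
    intro i; ring
  simp [this]

lemma volume_ne_zero (Q : DyadicCube n) : volume Q.toSet ≠ 0 := by
  rw [volume_toSet]; exact Q.side_rpow_ne_zero _

lemma volume_ne_top (Q : DyadicCube n) : volume Q.toSet ≠ ∞ := by
  rw [volume_toSet]; exact Q.side_rpow_ne_top _

lemma toSet_nonempty (Q : DyadicCube n) : Q.toSet.Nonempty := by
  rw [Set.nonempty_iff_ne_empty]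
  intro h
  exact Q.volume_ne_zero (by simp [h])

lemma mem_toSet_iff {Q : DyadicCube n} {x : Fin n → ℝ} :
    x ∈ Q.toSet ↔ ∀ i, ⌊x i * 2 ^ Q.k⌋ = Q.j i := by
  have h2 : (0 : ℝ) < 2 ^ Q.k := zpow_pos two_pos _
  have hs : (Q.side : ℝ) = (2 ^ Q.k)⁻¹ := by simp [side, zpow_neg]
  refine forall_congr' fun i => ?_
  rw [Int.floor_eq_iff, hs, inv_mul_le_iff₀ h2, lt_inv_mul_iff₀ h2, mul_comm (x i)]

/-- The integer position of the coarser cube is the floor quotient of the finer position by `2^m`,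
so it is the same for all points of `Q`. -/
lemma subset_of_le {Q R : DyadicCube n} (hk : R.k ≤ Q.k) {x : Fin n → ℝ} (hQ : x ∈ Q.toSet)
    (hR : x ∈ R.toSet) : Q.toSet ⊆ R.toSet := by
  obtain ⟨m, hm⟩ := Int.le.dest hk
  have key : ∀ t : ℝ, ⌊t * 2 ^ R.k⌋ = ⌊t * 2 ^ Q.k⌋ / ((2 ^ m : ℕ) : ℤ) := by
    intro t
    rw [← Int.floor_div_natCast, ← hm, zpow_add₀ two_ne_zero]
    congr 1
    push_cast
    rw [zpow_natCast]
    field_simp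
  rw [mem_toSet_iff] at hQ hR
  intro y hy
  rw [mem_toSet_iff] at hy ⊢
  intro i
  rw [key, hy i, ← hQ i, ← key, hR i]

lemma subset_or_subset {Q R : DyadicCube n} {x : Fin n → ℝ} (hQ : x ∈ Q.toSet)
    (hR : x ∈ R.toSet) : Q.toSet ⊆ R.toSet ∨ R.toSet ⊆ Q.toSet :=
  (le_total R.k Q.k).imp (fun h => subset_of_le h hQ hR) fun h => subset_of_le h hR hQ

lemma side_rpow_le {Q R : DyadicCube n} (hn : n ≠ 0) (h : Q.toSet ⊆ R.toSet) {s : ℝ}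
    (hs : 0 ≤ s) : (Q.side : ℝ≥0∞) ^ s ≤ (R.side : ℝ≥0∞) ^ s := by
  have := measure_mono (μ := volume) h
  rw [volume_toSet, volume_toSet] at this
  exact ENNReal.rpow_le_rpow ((ENNReal.rpow_le_rpow_iff (by positivity)).1 this) hs

/-- A cover of `Q` either has a cube containing `Q`, or its cubes inside `Q` already have a total
of at least `ℓ(Q)^d`. -/
lemma exists_superset_or_le_tsum {d : ℝ} (hd : 0 < d) (hdn : d < n) {Q : DyadicCube n}
    {𝒞 : Set (DyadicCube n)} (h : Q.toSet ⊆ ⋃ R ∈ 𝒞, R.toSet) :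
    (∃ R ∈ 𝒞, Q.toSet ⊆ R.toSet) ∨
      (Q.side : ℝ≥0∞) ^ d
        ≤ ∑' R : 𝒞, {R : DyadicCube n | R.toSet ⊆ Q.toSet}.indicator
            (fun R => (R.side : ℝ≥0∞) ^ d) R := by
  have hn : n ≠ 0 := by rintro rfl; norm_num at hdn; linarith
  by_cases hex : ∃ R ∈ 𝒞, Q.toSet ⊆ R.toSet
  · exact Or.inl hex
  right
  push Not at hex
  set I := {R : DyadicCube n | R.toSet ⊆ Q.toSet} with hI
  have hcov : Q.toSet ⊆ ⋃ R : 𝒞, ⋃ _ : (R : DyadicCube n) ∈ I, (R : DyadicCube n).toSet := by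
    intro x hx
    obtain ⟨R, hR, hxR⟩ := Set.mem_iUnion₂.1 (h hx)
    refine Set.mem_iUnion.2 ⟨⟨R, hR⟩, Set.mem_iUnion.2 ⟨?_, hxR⟩⟩
    exact (subset_or_subset hx hxR).resolve_left (hex R hR)
  -- Volume is countably subadditive, and `ℓ(R)^n ≤ ℓ(Q)^(n-d) ℓ(R)^d` for `R ⊆ Q`; cancelling
  -- `ℓ(Q)^(n-d)` leaves the claim.
  have hvol : (Q.side : ℝ≥0∞) ^ (n : ℝ)
      ≤ (Q.side : ℝ≥0∞) ^ (n - d) * ∑' R : 𝒞, I.indicator (fun R => (R.side : ℝ≥0∞) ^ d) R := by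
    rw [← volume_toSet, ← ENNReal.tsum_mul_left]
    refine (measure_mono hcov).trans ((measure_iUnion_le _).trans (ENNReal.tsum_le_tsum ?_))
    rintro ⟨R, hR⟩
    by_cases hRI : R ∈ I
    · simp only [hRI, Set.iUnion_true, Set.indicator_of_mem]
      rw [volume_toSet, show (n : ℝ) = (n - d) + d by ring, side_rpow_add]
      gcongr
      rw [show (n : ℝ) - d + d - d = n - d by ring]
      exact side_rpow_le hn hRI (by linarith)
    · simp [hRI]
  have h3 : (Q.side : ℝ≥0∞) ^ (n : ℝ) = (Q.side : ℝ≥0∞) ^ (n - d) * (Q.side : ℝ≥0∞) ^ d := by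
    rw [← side_rpow_add]; congr 1; ring
  rw [h3] at hvol
  exact (ENNReal.mul_le_mul_iff_right (Q.side_rpow_ne_zero _) (Q.side_rpow_ne_top _)).1 hvol

end DyadicCube

open DyadicCube

variable {n : ℕ}

lemma IsTiling.eq_of_mem {𝒯 : Set (DyadicCube n)} (h𝒯 : IsTiling 𝒯) {Q R : DyadicCube n}
    (hQ : Q ∈ 𝒯) (hR : R ∈ 𝒯) {x : Fin n → ℝ} (hxQ : x ∈ Q.toSet) (hxR : x ∈ R.toSet) : Q = R :=
  (h𝒯 x).unique ⟨hQ, hxQ⟩ ⟨hR, hxR⟩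

lemma tileSum_apply {𝒯 : Set (DyadicCube n)} (h𝒯 : IsTiling 𝒯) (a : DyadicCube n → ℝ≥0∞)
    {Q : DyadicCube n} (hQ : Q ∈ 𝒯) {x : Fin n → ℝ} (hx : x ∈ Q.toSet) :
    tileSum 𝒯 a x = a Q := by
  unfold tileSum
  rw [tsum_eq_single ⟨Q, hQ⟩]
  · simp [hx]
  · rintro ⟨R, hR⟩ hne
    refine Set.indicator_of_notMem (fun hxR => hne ?_) _
    exact Subtype.ext (h𝒯.eq_of_mem hR hQ hxR hx)

/-! ### The Hausdorff content -/

lemma hausdorffContent_mono {d : ℝ} {E F : Set (Fin n → ℝ)} (h : E ⊆ F) :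
    hausdorffContent d E ≤ hausdorffContent d F :=
  le_iInf₂ fun 𝒞 h𝒞 => iInf₂_le 𝒞 (h.trans h𝒞)

lemma hausdorffContent_le_tsum (d : ℝ) {E : Set (Fin n → ℝ)} {𝒞 : Set (DyadicCube n)}
    (h : E ⊆ ⋃ Q ∈ 𝒞, Q.toSet) :
    hausdorffContent d E ≤ ∑' Q : 𝒞, ((Q : DyadicCube n).side : ℝ≥0∞) ^ d :=
  iInf₂_le 𝒞 h

@[simp] lemma hausdorffContent_empty (d : ℝ) :
    hausdorffContent d (∅ : Set (Fin n → ℝ)) = 0 := by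
  have := hausdorffContent_le_tsum (n := n) d (Set.empty_subset (⋃ Q ∈ (∅ : Set (DyadicCube n)), Q.toSet))
  simpa using this

lemma hausdorffContent_union_le (d : ℝ) (E F : Set (Fin n → ℝ)) :
    hausdorffContent d (E ∪ F) ≤ hausdorffContent d E + hausdorffContent d F := by
  unfold hausdorffContent
  simp only [ENNReal.iInf_add, ENNReal.add_iInf]
  refine le_iInf₂ fun 𝒜 h𝒜 => le_iInf₂ fun ℬ hℬ => (iInf₂_le (ℬ ∪ 𝒜) ?_).trans ?_
  · rw [Set.biUnion_union]
    exact Set.union_subset_union hℬ h𝒜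
  · exact ENNReal.tsum_union_le (fun Q : DyadicCube n => (Q.side : ℝ≥0∞) ^ d) _ _

lemma le_hausdorffContent {d : ℝ} (hd : 0 < d) (hdn : d < n) {Q : DyadicCube n}
    {E : Set (Fin n → ℝ)} (h : Q.toSet ⊆ E) :
    (Q.side : ℝ≥0∞) ^ d ≤ hausdorffContent d E := by
  have hn : n ≠ 0 := by rintro rfl; norm_num at hdn; linarith
  refine le_iInf₂ fun 𝒞 h𝒞 => ?_
  rcases exists_superset_or_le_tsum hd hdn (h.trans h𝒞) with ⟨R, hR, hQR⟩ | hle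
  · exact (side_rpow_le hn hQR hd.le).trans
      (ENNReal.le_tsum (f := fun Q : 𝒞 => ((Q : DyadicCube n).side : ℝ≥0∞) ^ d) ⟨R, hR⟩)
  · exact hle.trans (ENNReal.tsum_le_tsum fun R => Set.indicator_le_self _ _ _)

/-! ### The Choquet integral -/

lemma measurable_content_level (d : ℝ) (F : (Fin n → ℝ) → ℝ≥0∞) :
    Measurable fun t : ℝ => hausdorffContent d {x | ENNReal.ofReal t < F x} := by
  refine Antitone.measurable fun s t hst => hausdorffContent_mono fun x hx => ?_
  exact (ENNReal.ofReal_le_ofReal hst).trans_lt hx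

/-- A level set of a maximum is the union of the two level sets, so subadditivity of the content
suffices and no constant is lost. -/
lemma choquetIntegral_max_le (d : ℝ) (F G : (Fin n → ℝ) → ℝ≥0∞) :
    choquetIntegral d (fun x => max (F x) (G x)) ≤ choquetIntegral d F + choquetIntegral d G := by
  unfold choquetIntegral
  rw [← lintegral_add_left (measurable_content_level d F)]
  refine lintegral_mono fun t => ?_
  have : {x | ENNReal.ofReal t < max (F x) (G x)}
      = {x | ENNReal.ofReal t < F x} ∪ {x | ENNReal.ofReal t < G x} := by
    ext x; simp
  simp only [this]
  exact hausdorffContent_union_le _ _ _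

lemma lintegral_Ioi_indicator_lt (a : ℝ≥0∞) (c : ℝ≥0∞) :
    ∫⁻ t in Set.Ioi (0 : ℝ), (if ENNReal.ofReal t < a then c else 0) = c * a := by
  have hm : Measurable fun t : ℝ => (if ENNReal.ofReal t < a then (1 : ℝ≥0∞) else 0) :=
    Measurable.ite (measurableSet_lt ENNReal.measurable_ofReal measurable_const)
      measurable_const measurable_const
  have h1 : ∀ t : ℝ, (if ENNReal.ofReal t < a then c else 0)
      = c * (if ENNReal.ofReal t < a then (1 : ℝ≥0∞) else 0) := by
    intro t; split_ifs <;> simp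
  simp_rw [h1]
  rw [lintegral_const_mul _ hm]
  congr 1
  have h2 : (fun t : ℝ => (if ENNReal.ofReal t < a then (1 : ℝ≥0∞) else 0))
      = {t : ℝ | ENNReal.ofReal t < a}.indicator 1 := by
    ext t; simp [Set.indicator_apply]
  have hs : MeasurableSet {t : ℝ | ENNReal.ofReal t < a} :=
    measurableSet_lt ENNReal.measurable_ofReal measurable_const
  rw [h2, lintegral_indicator_one hs, Measure.restrict_apply hs]
  by_cases ha : a = ∞
  · subst ha; simp
  · have : {t : ℝ | ENNReal.ofReal t < a} ∩ Set.Ioi 0 = Set.Ioo 0 a.toReal := by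
      ext t
      simp only [Set.mem_inter_iff, Set.mem_ofPred_eq, Set.mem_Ioi, Set.mem_Ioo]
      rw [and_comm]
      refine and_congr_right fun ht => ?_
      rw [ENNReal.ofReal_lt_iff_lt_toReal ht.le ha]
    rw [this, Real.volume_Ioo, sub_zero, ENNReal.ofReal_toReal ha]

lemma mul_le_choquetIntegral {d : ℝ} (hd : 0 < d) (hdn : d < n) {Q : DyadicCube n}
    {F : (Fin n → ℝ) → ℝ≥0∞} {a : ℝ≥0∞} (h : ∀ x ∈ Q.toSet, a ≤ F x) :
    (Q.side : ℝ≥0∞) ^ d * a ≤ choquetIntegral d F := by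
  rw [← lintegral_Ioi_indicator_lt]
  refine lintegral_mono fun t => ?_
  split_ifs with hta
  · exact le_hausdorffContent hd hdn fun x hx => lt_of_lt_of_le hta (h x hx)
  · exact zero_le

/-- The Choquet integral of `∑ a_Q 1_Q` is at most `∑ ℓ(Q)^d a_Q`. -/
lemma choquetIntegral_tileSum_le (d : ℝ) {𝒯 : Set (DyadicCube n)} (h𝒯 : IsTiling 𝒯)
    (a : DyadicCube n → ℝ≥0∞) :
    choquetIntegral d (tileSum 𝒯 a)
      ≤ ∑' Q : 𝒯, ((Q : DyadicCube n).side : ℝ≥0∞) ^ d * a Q := by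
  simp_rw [← lintegral_Ioi_indicator_lt]
  rw [← lintegral_tsum fun Q => (Measurable.ite
    (measurableSet_lt ENNReal.measurable_ofReal measurable_const)
      measurable_const measurable_const).aemeasurable]
  refine lintegral_mono fun t => ?_
  have hcov : {x | ENNReal.ofReal t < tileSum 𝒯 a x}
      ⊆ ⋃ Q ∈ {Q : DyadicCube n | Q ∈ 𝒯 ∧ ENNReal.ofReal t < a Q}, Q.toSet := by
    intro x hx
    obtain ⟨Q, ⟨hQ, hxQ⟩, -⟩ := h𝒯 x
    rw [Set.mem_ofPred_eq, tileSum_apply h𝒯 a hQ hxQ] at hx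
    exact Set.mem_biUnion (show Q ∈ {Q : DyadicCube n | _} from ⟨hQ, hx⟩) hxQ
  refine (hausdorffContent_le_tsum d hcov).trans ?_
  rw [tsum_subtype {Q : DyadicCube n | Q ∈ 𝒯 ∧ ENNReal.ofReal t < a Q}
      (fun Q => (Q.side : ℝ≥0∞) ^ d),
    tsum_subtype 𝒯 (fun Q => if ENNReal.ofReal t < a Q then (Q.side : ℝ≥0∞) ^ d else 0)]
  refine (tsum_congr fun Q => ?_).le
  by_cases hQ : Q ∈ 𝒯 <;> by_cases hta : ENNReal.ofReal t < a Q <;> simp [hQ, hta]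

lemma choquetIntegral_const_mul {d : ℝ} {c : ℝ≥0} (hc : c ≠ 0) (F : (Fin n → ℝ) → ℝ≥0∞) :
    choquetIntegral d (fun x => c * F x) = c * choquetIntegral d F := by
  have hc' : (c : ℝ) ≠ 0 := by simpa using hc
  have hcpos : 0 < (c : ℝ) := by positivity
  unfold choquetIntegral
  set φ : ℝ → ℝ≥0∞ := (Set.Ioi (0 : ℝ)).indicator
    fun t => hausdorffContent d {x | ENNReal.ofReal t < c * F x} with hφ
  have hφm : Measurable φ := (measurable_content_level d fun x => c * F x).indicator measurableSet_Ioi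
  have hφ' : ∀ t, φ (c * t) = (Set.Ioi (0 : ℝ)).indicator
      (fun t => hausdorffContent d {x | ENNReal.ofReal t < F x}) t := by
    intro t
    simp only [hφ, Set.indicator_apply, Set.mem_Ioi, mul_pos_iff_of_pos_left hcpos]
    refine if_congr Iff.rfl (congrArg _ ?_) rfl
    ext x
    rw [Set.mem_ofPred_eq, Set.mem_ofPred_eq, ENNReal.ofReal_mul hcpos.le, ENNReal.ofReal_coe_nnreal,
      ENNReal.mul_lt_mul_iff_right (by simpa using hc) ENNReal.coe_ne_top]
  rw [← lintegral_indicator measurableSet_Ioi, ← lintegral_indicator measurableSet_Ioi]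
  simp_rw [← hφ']
  change ∫⁻ t, φ t = _
  conv_lhs => rw [← Real.smul_map_volume_mul_left hc']
  rw [lintegral_smul_measure, lintegral_map hφm (measurable_const_mul _), abs_of_pos hcpos,
    ENNReal.ofReal_coe_nnreal, smul_eq_mul]

/-- The content of `{G > t}` decreases in `t`, so its integral over `(2^(m-1), 2^m]`, of length
`2^(m-1)`, is at least half of the `m`-th term. -/
lemma tsum_zpow_mul_content_le (d : ℝ) (G : (Fin n → ℝ) → ℝ≥0∞) :
    ∑' m : ℤ, (2 : ℝ≥0∞) ^ m * hausdorffContent d {x | (2 : ℝ≥0∞) ^ m < G x}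
      ≤ 2 * choquetIntegral d G := by
  set φ : ℝ → ℝ≥0∞ := fun t => hausdorffContent d {x | ENNReal.ofReal t < G x} with hφ
  have hz : ∀ m : ℤ, ENNReal.ofReal ((2 : ℝ) ^ m) = (2 : ℝ≥0∞) ^ m := by
    intro m
    have : (2 : ℝ) ^ m = (((2 : ℝ≥0) ^ m : ℝ≥0) : ℝ) := by simp
    rw [this, ENNReal.ofReal_coe_nnreal, ENNReal.coe_zpow two_ne_zero, ENNReal.coe_ofNat]
  have h1 : ∀ m : ℤ, (2 : ℝ≥0∞) ^ m * hausdorffContent d {x | (2 : ℝ≥0∞) ^ m < G x}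
      ≤ 2 * ∫⁻ t in Set.Ioc ((2 : ℝ) ^ (m - 1)) (2 ^ m), φ t := by
    intro m
    have hlen : (2 : ℝ) ^ m - 2 ^ (m - 1) = 2 ^ (m - 1) := by
      have : (2 : ℝ) ^ m = 2 ^ (m - 1) * 2 := by
        rw [← zpow_add_one₀ two_ne_zero]; simp
      rw [this]; ring
    have hc : φ (2 ^ m) * (2 : ℝ≥0∞) ^ (m - 1)
        ≤ ∫⁻ t in Set.Ioc ((2 : ℝ) ^ (m - 1)) (2 ^ m), φ t := by
      calc φ (2 ^ m) * (2 : ℝ≥0∞) ^ (m - 1)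
          = ∫⁻ t in Set.Ioc ((2 : ℝ) ^ (m - 1)) (2 ^ m), φ (2 ^ m) := by
            rw [setLIntegral_const, Real.volume_Ioc, hlen, hz]
        _ ≤ _ := by
            refine setLIntegral_mono' measurableSet_Ioc fun t ht => ?_
            exact hausdorffContent_mono fun x hx =>
              (ENNReal.ofReal_le_ofReal ht.2).trans_lt hx
    have hzm : (2 : ℝ≥0∞) ^ m = 2 * 2 ^ (m - 1) := by
      conv_lhs => rw [show m = 1 + (m - 1) by ring]
      rw [ENNReal.zpow_add two_ne_zero ENNReal.ofNat_ne_top, zpow_one]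
    calc (2 : ℝ≥0∞) ^ m * hausdorffContent d {x | (2 : ℝ≥0∞) ^ m < G x}
        = 2 * (φ (2 ^ m) * (2 : ℝ≥0∞) ^ (m - 1)) := by
          simp only [hφ, hz]
          nth_rewrite 1 [hzm]
          ring
      _ ≤ _ := by gcongr
  have hdisj : Pairwise (Function.onFun Disjoint
      fun m : ℤ => Set.Ioc ((2 : ℝ) ^ (m - 1)) (2 ^ m)) := by
    intro i j hij
    wlog hlt : i < j generalizing i j
    · exact (this hij.symm (lt_of_le_of_ne (not_lt.1 hlt) hij.symm)).symm
    refine Set.disjoint_left.2 fun t hi hj => ?_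
    have : (2 : ℝ) ^ i ≤ 2 ^ (j - 1) := zpow_le_zpow_right₀ one_le_two (by omega)
    exact absurd hj.1 (not_lt.2 (hi.2.trans this))
  calc _ ≤ ∑' m : ℤ, 2 * ∫⁻ t in Set.Ioc ((2 : ℝ) ^ (m - 1)) (2 ^ m), φ t :=
        ENNReal.tsum_le_tsum h1
    _ = 2 * ∫⁻ t in ⋃ m : ℤ, Set.Ioc ((2 : ℝ) ^ (m - 1)) (2 ^ m), φ t := by
        rw [ENNReal.tsum_mul_left, lintegral_iUnion (fun _ => measurableSet_Ioc) hdisj]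
    _ ≤ _ := by
        gcongr
        refine lintegral_mono_set (Set.iUnion_subset fun m t ht => ?_)
        exact (zpow_pos two_pos _).trans ht.1

/-! ### The discrete Carleson embedding -/

/-- One level set of the Carleson embedding. -/
lemma tsum_le_content_of_carleson {d : ℝ} (hd : 0 < d) (hdn : d < n) {𝒯 : Set (DyadicCube n)}
    (h𝒯 : IsTiling 𝒯) {a b : DyadicCube n → ℝ≥0∞}
    (hcar : ∀ R : DyadicCube n, ∑' Q, {Q | Q ∈ 𝒯 ∧ Q.toSet ⊆ R.toSet}.indicator
      (fun Q => (Q.side : ℝ≥0∞) ^ d * b Q) Q ≤ 2 * ((R.side : ℝ≥0∞) ^ d * b R))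
    {𝒮 : Set (DyadicCube n)} (h𝒮 : 𝒮 ⊆ 𝒯) {E : Set (Fin n → ℝ)} (hE : ∀ Q ∈ 𝒮, Q.toSet ⊆ E)
    {c : ℝ≥0∞} (hc0 : c ≠ 0) (hc : c ≠ ∞)
    (hab : ∀ Q ∈ 𝒮, ∀ R : DyadicCube n, Q.toSet ⊆ R.toSet → a Q * b R ≤ c) :
    ∑' Q, 𝒮.indicator (fun Q => (Q.side : ℝ≥0∞) ^ d * (a Q * b Q)) Q
      ≤ 3 * c * hausdorffContent d E := by
  have h3c0 : 3 * c ≠ 0 := mul_ne_zero three_ne_zero hc0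
  have h3c : 3 * c ≠ ∞ := ENNReal.mul_ne_top ENNReal.ofNat_ne_top hc
  rw [← ENNReal.div_le_iff' h3c0 h3c]
  refine le_iInf₂ fun 𝒞 h𝒞 => ?_
  rw [ENNReal.div_le_iff' h3c0 h3c]
  -- `u` assigns tiles to the covering cubes that contain them; `v` charges the remaining tiles to
  -- the covering cubes that they contain.
  set u : DyadicCube n → DyadicCube n → ℝ≥0∞ := fun Q R =>
    {Q | Q ∈ 𝒮 ∧ Q.toSet ⊆ R.toSet}.indicator (fun Q => (Q.side : ℝ≥0∞) ^ d * (a Q * b Q)) Q with hu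
  set v : DyadicCube n → DyadicCube n → ℝ≥0∞ := fun Q R =>
    {Q | Q ∈ 𝒮 ∧ R.toSet ⊆ Q.toSet}.indicator (fun _ => c * (R.side : ℝ≥0∞) ^ d) Q with hv
  have hpt : ∀ Q, 𝒮.indicator (fun Q => (Q.side : ℝ≥0∞) ^ d * (a Q * b Q)) Q
      ≤ ∑' R : 𝒞, (u Q R + v Q R) := by
    intro Q
    by_cases hQ : Q ∈ 𝒮
    swap
    · simp [hQ]
    rw [Set.indicator_of_mem hQ]
    rcases exists_superset_or_le_tsum hd hdn ((hE Q hQ).trans h𝒞) with ⟨R, hR, hQR⟩ | hle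
    · refine le_trans ?_ (ENNReal.le_tsum ⟨R, hR⟩)
      simp [hu, hQ, hQR]
    · calc (Q.side : ℝ≥0∞) ^ d * (a Q * b Q)
          ≤ (∑' R : 𝒞, {R : DyadicCube n | R.toSet ⊆ Q.toSet}.indicator
            (fun R => (R.side : ℝ≥0∞) ^ d) R) * c := by
            gcongr
            exact hab Q hQ Q subset_rfl
        _ ≤ _ := by
            rw [← ENNReal.tsum_mul_right]
            refine ENNReal.tsum_le_tsum fun R => ?_
            by_cases hRQ : (R : DyadicCube n).toSet ⊆ Q.toSet
            · refine le_trans ?_ (le_add_self)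
              simp [hv, hQ, hRQ, mul_comm]
            · simp [hRQ]
  have hu' : ∀ R, ∑' Q, u Q R ≤ 2 * c * (R.side : ℝ≥0∞) ^ d := by
    intro R
    have hle : ∀ Q, b R * u Q R ≤ c * {Q | Q ∈ 𝒯 ∧ Q.toSet ⊆ R.toSet}.indicator
        (fun Q => (Q.side : ℝ≥0∞) ^ d * b Q) Q := by
      intro Q
      by_cases hQ : Q ∈ 𝒮 ∧ Q.toSet ⊆ R.toSet
      · have hQ' : Q ∈ 𝒯 ∧ Q.toSet ⊆ R.toSet := ⟨h𝒮 hQ.1, hQ.2⟩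
        simp only [hu, Set.mem_ofPred_eq, hQ, hQ', and_self, Set.indicator_of_mem]
        calc b R * ((Q.side : ℝ≥0∞) ^ d * (a Q * b Q))
            = a Q * b R * ((Q.side : ℝ≥0∞) ^ d * b Q) := by ring
          _ ≤ _ := by gcongr; exact hab Q hQ.1 R hQ.2
      · simp [hu, Set.indicator_of_notMem (s := {Q | Q ∈ 𝒮 ∧ Q.toSet ⊆ R.toSet}) hQ]
    -- Multiplying by `b R` replaces each `a Q` by the bound `a Q * b R ≤ c`, leaving exactly the
    -- packing sum. Cancelling `b R` needs it nonzero and finite: if `b R = 0`, packing kills every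
    -- `b Q`; if `b R = ∞`, finiteness of `c` kills every `a Q`.
    have hmul : b R * ∑' Q, u Q R ≤ b R * (2 * c * (R.side : ℝ≥0∞) ^ d) := by
      rw [← ENNReal.tsum_mul_left]
      refine (ENNReal.tsum_le_tsum hle).trans ?_
      rw [ENNReal.tsum_mul_left]
      calc _ ≤ c * (2 * ((R.side : ℝ≥0∞) ^ d * b R)) := by gcongr; exact hcar R
        _ = _ := by ring
    rcases eq_or_ne (b R) 0 with hb | hb
    · have h0 := hcar R
      rw [hb, mul_zero, mul_zero, nonpos_iff_eq_zero, ENNReal.tsum_eq_zero] at h0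
      have : ∀ Q, u Q R = 0 := by
        intro Q
        by_cases hQ : Q ∈ 𝒮 ∧ Q.toSet ⊆ R.toSet
        · have := h0 Q
          have hQ' : Q ∈ 𝒯 ∧ Q.toSet ⊆ R.toSet := ⟨h𝒮 hQ.1, hQ.2⟩
          rw [Set.indicator_of_mem (s := {Q | Q ∈ 𝒯 ∧ Q.toSet ⊆ R.toSet}) hQ'] at this
          have hbQ := (mul_eq_zero.1 this).resolve_left (Q.side_rpow_ne_zero d)
          simp [hu, hbQ]
        · simp [hu, hQ]
      simp [this]
    · rcases eq_or_ne (b R) ∞ with hb' | hb'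
      · have : ∀ Q, u Q R = 0 := by
          intro Q
          by_cases hQ : Q ∈ 𝒮 ∧ Q.toSet ⊆ R.toSet
          · have haQ : a Q = 0 := by
              by_contra h0
              have := hab Q hQ.1 R hQ.2
              rw [hb', ENNReal.mul_top h0] at this
              exact hc (top_le_iff.1 this)
            simp [hu, haQ]
          · simp [hu, hQ]
        simp [this]
      · exact (ENNReal.mul_le_mul_iff_right hb hb').1 hmul
  -- Tiles are disjoint, so a covering cube lies in at most one of them and is charged once.
  have hv' : ∀ R, ∑' Q, v Q R ≤ c * (R.side : ℝ≥0∞) ^ d := by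
    intro R
    by_cases hex : ∃ Q ∈ 𝒮, R.toSet ⊆ Q.toSet
    · obtain ⟨Q, hQ, hRQ⟩ := hex
      rw [tsum_eq_single Q]
      · exact Set.indicator_le_self _ _ _
      · intro Q' hne
        refine Set.indicator_of_notMem (fun h' => hne ?_) _
        obtain ⟨x, hx⟩ := R.toSet_nonempty
        exact h𝒯.eq_of_mem (h𝒮 h'.1) (h𝒮 hQ) (h'.2 hx) (hRQ hx)
    · push Not at hex
      have : ∀ Q, v Q R = 0 := fun Q =>
        Set.indicator_of_notMem (fun h' => hex Q h'.1 h'.2) _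
      simp [this]
  calc _ ≤ ∑' Q, ∑' R : 𝒞, (u Q R + v Q R) := ENNReal.tsum_le_tsum hpt
    _ = ∑' R : 𝒞, (∑' Q, u Q R + ∑' Q, v Q R) := by
        rw [ENNReal.tsum_comm]
        exact tsum_congr fun R => ENNReal.tsum_add
    _ ≤ ∑' R : 𝒞, 3 * c * ((R : DyadicCube n).side : ℝ≥0∞) ^ d := by
        refine ENNReal.tsum_le_tsum fun R => (add_le_add (hu' R) (hv' R)).trans_eq ?_
        ring
    _ = _ := ENNReal.tsum_mul_left

/-- The Carleson embedding for the dyadic Hausdorff content. -/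
lemma tsum_le_choquetIntegral_of_carleson {d : ℝ} (hd : 0 < d) (hdn : d < n)
    {𝒯 : Set (DyadicCube n)} (h𝒯 : IsTiling 𝒯) {a b : DyadicCube n → ℝ≥0∞}
    (hcar : ∀ R : DyadicCube n, ∑' Q, {Q | Q ∈ 𝒯 ∧ Q.toSet ⊆ R.toSet}.indicator
      (fun Q => (Q.side : ℝ≥0∞) ^ d * b Q) Q ≤ 2 * ((R.side : ℝ≥0∞) ^ d * b R))
    {G : (Fin n → ℝ) → ℝ≥0∞}
    (hG : ∀ Q ∈ 𝒯, ∀ R : DyadicCube n, Q.toSet ⊆ R.toSet → ∀ x ∈ Q.toSet, a Q * b R ≤ G x) :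
    ∑' Q : 𝒯, ((Q : DyadicCube n).side : ℝ≥0∞) ^ d * (a Q * b Q)
      ≤ 12 * choquetIntegral d G := by
  -- Sorting tiles by the infimum of `G` puts a tile of level `m` inside `{G > 2^m}` while keeping
  -- `a Q * b R ≤ 2^(m+1)`. The values `∞` and `0`, which have no level, are treated separately.
  set γ : DyadicCube n → ℝ≥0∞ := fun Q => ⨅ x ∈ Q.toSet, G x with hγ
  by_cases htop : ∃ Q ∈ 𝒯, γ Q = ∞
  · obtain ⟨Q, -, hQ⟩ := htop
    have := mul_le_choquetIntegral hd hdn (Q := Q) (F := G) (a := ∞)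
      (fun x hx => hQ ▸ iInf₂_le x hx)
    rw [ENNReal.mul_top (Q.side_rpow_ne_zero d), top_le_iff] at this
    simp [this]
  push Not at htop
  set 𝒮 : ℤ → Set (DyadicCube n) := fun m =>
    {Q | Q ∈ 𝒯 ∧ γ Q ∈ Set.Ioc ((2 : ℝ≥0∞) ^ m) (2 ^ (m + 1))} with h𝒮
  have habγ : ∀ Q ∈ 𝒯, ∀ R : DyadicCube n, Q.toSet ⊆ R.toSet → a Q * b R ≤ γ Q :=
    fun Q hQ R hQR => le_iInf₂ fun x hx => hG Q hQ R hQR x hx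
  have hpt : ∀ Q, 𝒯.indicator (fun Q => (Q.side : ℝ≥0∞) ^ d * (a Q * b Q)) Q
      ≤ ∑' m : ℤ, (𝒮 m).indicator (fun Q => (Q.side : ℝ≥0∞) ^ d * (a Q * b Q)) Q := by
    intro Q
    by_cases hQ : Q ∈ 𝒯
    swap
    · simp [hQ]
    rw [Set.indicator_of_mem hQ]
    rcases eq_or_ne (γ Q) 0 with h0 | h0
    · have := habγ Q hQ Q subset_rfl
      rw [h0, nonpos_iff_eq_zero] at this
      simp [this]
    obtain ⟨m, hm⟩ := ENNReal.exists_mem_Ioc_zpow h0 (htop Q hQ) ENNReal.one_lt_two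
      ENNReal.ofNat_ne_top
    refine le_trans ?_ (ENNReal.le_tsum m)
    rw [Set.indicator_of_mem (show Q ∈ 𝒮 m from ⟨hQ, hm⟩)]
  have hlev : ∀ m : ℤ,
      ∑' Q, (𝒮 m).indicator (fun Q => (Q.side : ℝ≥0∞) ^ d * (a Q * b Q)) Q
        ≤ 6 * ((2 : ℝ≥0∞) ^ m * hausdorffContent d {x | (2 : ℝ≥0∞) ^ m < G x}) := by
    intro m
    have := tsum_le_content_of_carleson hd hdn h𝒯 hcar (𝒮 := 𝒮 m) (fun Q hQ => hQ.1)
      (E := {x | (2 : ℝ≥0∞) ^ m < G x})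
      (fun Q hQ x hx => lt_of_lt_of_le hQ.2.1 (iInf₂_le x hx))
      (c := 2 ^ (m + 1)) (ENNReal.zpow_pos two_ne_zero ENNReal.ofNat_ne_top _).ne'
      (ENNReal.zpow_lt_top two_ne_zero ENNReal.ofNat_ne_top _).ne
      (fun Q hQ R hQR => (habγ Q hQ.1 R hQR).trans hQ.2.2)
    refine this.trans_eq ?_
    rw [ENNReal.zpow_add two_ne_zero ENNReal.ofNat_ne_top, zpow_one]
    ring
  rw [tsum_subtype 𝒯 (fun Q => (Q.side : ℝ≥0∞) ^ d * (a Q * b Q))]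
  calc _ ≤ ∑' Q, ∑' m : ℤ,
        (𝒮 m).indicator (fun Q => (Q.side : ℝ≥0∞) ^ d * (a Q * b Q)) Q :=
        ENNReal.tsum_le_tsum hpt
    _ ≤ ∑' m : ℤ, 6 * ((2 : ℝ≥0∞) ^ m * hausdorffContent d {x | (2 : ℝ≥0∞) ^ m < G x}) := by
        rw [ENNReal.tsum_comm]
        exact ENNReal.tsum_le_tsum hlev
    _ ≤ 6 * (2 * choquetIntegral d G) := by
        rw [ENNReal.tsum_mul_left]
        gcongr
        exact tsum_zpow_mul_content_le d G
    _ = _ := by ring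

/-! ### Young functions -/

lemma IsYoung.map_mul_le {Φ : ℝ≥0 → ℝ≥0∞} (hΦ : IsYoung Φ) {c : ℝ≥0} (hc : c ≤ 1) (t : ℝ≥0) :
    Φ (c * t) ≤ c * Φ t := by
  have := hΦ.convex.2 (Set.mem_univ t) (Set.mem_univ 0) (zero_le (a := c))
    (zero_le (a := 1 - c)) (add_tsub_cancel_of_le hc)
  simpa [hΦ.map_zero, ENNReal.smul_def] using this

@[simp] lemma complementary_zero (Φ : ℝ≥0 → ℝ≥0∞) : complementary Φ 0 = 0 := by
  simp [complementary]

lemma complementary_mul_le {Φ : ℝ≥0 → ℝ≥0∞} {c : ℝ≥0} (hc : c ≤ 1) (t : ℝ≥0) :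
    complementary Φ (c * t) ≤ c * complementary Φ t := by
  refine iSup_le fun s => ?_
  calc ((c * t : ℝ≥0) : ℝ≥0∞) * s - Φ s ≤ c * (t * s) - c * Φ s := by
        rw [ENNReal.coe_mul, mul_assoc]
        refine tsub_le_tsub_left ?_ _
        exact mul_le_of_le_one_left zero_le (by exact_mod_cast hc)
    _ = c * (t * s - Φ s) := (ENNReal.mul_sub fun _ _ => ENNReal.coe_ne_top).symm
    _ ≤ _ := by
        gcongr
        exact le_iSup (fun s : ℝ≥0 => (t : ℝ≥0∞) * s - Φ s) s

/-- Young's inequality. -/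
lemma mul_le_add_complementary (Φ : ℝ≥0 → ℝ≥0∞) (s t : ℝ≥0) :
    (s : ℝ≥0∞) * t ≤ Φ s + complementary Φ t := by
  rw [add_comm, ← tsub_le_iff_right, mul_comm]
  exact le_iSup (fun s : ℝ≥0 => (t : ℝ≥0∞) * s - Φ s) s

/-- By convexity `Φ(s)/s` is nondecreasing. Hence `sΦ(t)/t - Φ(s)` is at most `Φ(t)` for `s ≤ t` and
nonpositive for `s ≥ t`. -/
lemma complementary_div_self_le {Φ : ℝ≥0 → ℝ≥0∞} (hΦ : IsYoung Φ) (hfin : ∀ t, Φ t ≠ ∞)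
    (t : ℝ≥0) : complementary Φ ((Φ t).toNNReal / t) ≤ Φ t := by
  rcases eq_or_ne t 0 with rfl | ht
  · simp
  refine iSup_le fun s => ?_
  have hcast : ∀ c : ℝ≥0, (c : ℝ≥0∞) * Φ t = ((c * (Φ t).toNNReal : ℝ≥0) : ℝ≥0∞) := by
    intro c
    rw [ENNReal.coe_mul, ENNReal.coe_toNNReal (hfin t)]
  have heq : (((Φ t).toNNReal / t : ℝ≥0) : ℝ≥0∞) * s = ((s / t : ℝ≥0) : ℝ≥0∞) * Φ t := by
    rw [hcast, ← ENNReal.coe_mul]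
    congr 1
    ring
  rw [heq]
  rcases le_total s t with hst | hst
  · refine tsub_le_self.trans (mul_le_of_le_one_left zero_le ?_)
    exact_mod_cast div_le_one_of_le₀ hst zero_le
  · have hs : s ≠ 0 := (lt_of_lt_of_le (pos_iff_ne_zero.2 ht) hst).ne'
    have h1 := hΦ.map_mul_le (div_le_one_of_le₀ hst zero_le) s
    rw [div_mul_cancel₀ _ hs] at h1
    have h2 : ((s / t : ℝ≥0) : ℝ≥0∞) * Φ t ≤ Φ s := by
      calc ((s / t : ℝ≥0) : ℝ≥0∞) * Φ t ≤ ((s / t : ℝ≥0) : ℝ≥0∞) * (((t / s : ℝ≥0) : ℝ≥0∞) * Φ s) := by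
            gcongr
        _ = Φ s := by
            rw [← mul_assoc, ← ENNReal.coe_mul]
            have : s / t * (t / s) = 1 := by field_simp
            rw [this]; simp
    rw [tsub_eq_zero_of_le h2]
    exact zero_le

/-- Under the `Δ₂`-condition a Young function is finite, or infinite off the origin. -/
lemma Delta2.finite_or_top {Φ : ℝ≥0 → ℝ≥0∞} (hΦ : IsYoung Φ) (hΔ : Delta2 Φ) :
    (∀ t, Φ t ≠ ∞) ∨ ∀ t, t ≠ 0 → Φ t = ∞ := by
  by_contra! h
  obtain ⟨⟨t, ht⟩, s, hs, hfin⟩ := h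
  obtain ⟨K, -, hK⟩ := hΔ
  have hpow : ∀ m : ℕ, Φ (2 ^ m * s) ≠ ∞ := by
    intro m
    induction m with
    | zero => simpa using hfin
    | succ m ih =>
      rw [pow_succ', mul_assoc]
      refine ne_top_of_le_ne_top (ENNReal.mul_ne_top ENNReal.coe_ne_top ih) (hK _ ?_)
      positivity
  obtain ⟨m, hm⟩ := pow_unbounded_of_one_lt (t / s) (one_lt_two (α := ℝ≥0))
  refine hpow m (top_le_iff.1 (ht ▸ hΦ.monotone ?_))
  exact ((div_lt_iff₀ (pos_iff_ne_zero.2 hs)).1 hm).le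

/-- At least linear growth at infinity is what makes a zero Luxemburg average force `f = 0` almost
everywhere on the cube. -/
lemma IsYoung.exists_le_mul_one_add {Φ : ℝ≥0 → ℝ≥0∞} (hΦ : IsYoung Φ) :
    ∃ s₀ : ℝ≥0, ∀ s : ℝ≥0, (s : ℝ≥0∞) ≤ s₀ * (1 + Φ s) := by
  obtain ⟨s₀, h0, hs₀⟩ := ((eventually_gt_atTop (0 : ℝ≥0)).and
    (hΦ.tendsto_top.eventually (lt_mem_nhds ENNReal.one_lt_top))).exists
  refine ⟨s₀, fun s => ?_⟩
  rcases le_total s s₀ with h | h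
  · calc (s : ℝ≥0∞) ≤ s₀ * 1 := by simpa using h
      _ ≤ _ := by gcongr; exact le_self_add
  · have hs : s ≠ 0 := (h0.trans_le h).ne'
    have h1 := hΦ.map_mul_le (div_le_one_of_le₀ h zero_le) s
    rw [div_mul_cancel₀ _ hs] at h1
    calc (s : ℝ≥0∞) = s * 1 := (mul_one _).symm
      _ ≤ s * (((s₀ / s : ℝ≥0) : ℝ≥0∞) * Φ s) := by gcongr; exact hs₀.le.trans h1
      _ = s₀ * Φ s := by
          rw [← mul_assoc, ← ENNReal.coe_mul, mul_div_cancel₀ _ hs]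
      _ ≤ _ := by gcongr; exact le_add_self

lemma exists_le_mul_one_add_complementary {Φ : ℝ≥0 → ℝ≥0∞} (hfin : ∀ t, Φ t ≠ ∞) :
    ∃ s₀ : ℝ≥0, ∀ s : ℝ≥0, (s : ℝ≥0∞) ≤ s₀ * (1 + complementary Φ s) := by
  refine ⟨max 1 (Φ 1).toNNReal, fun s => ?_⟩
  have h := mul_le_add_complementary Φ 1 s
  rw [ENNReal.coe_one, one_mul] at h
  refine h.trans ?_
  rw [mul_add, mul_one]
  gcongr
  · calc Φ 1 = ((Φ 1).toNNReal : ℝ≥0∞) := (ENNReal.coe_toNNReal (hfin 1)).symm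
      _ ≤ _ := by exact_mod_cast le_max_right _ _
  · exact le_mul_of_one_le_left zero_le (by exact_mod_cast le_max_left _ _)

/-! ### Luxemburg averages -/

variable {Ψ : ℝ≥0 → ℝ≥0∞} {Q : DyadicCube n} {f g : (Fin n → ℝ) → ℝ}

lemma laverage_le_one_iff {F : (Fin n → ℝ) → ℝ≥0∞} :
    ⨍⁻ x in Q.toSet, F x ∂volume ≤ 1 ↔ ∫⁻ x in Q.toSet, F x ≤ volume Q.toSet := by
  rw [setLAverage_eq, ENNReal.div_le_iff Q.volume_ne_zero Q.volume_ne_top, one_mul]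

lemma luxemburg_le {l : ℝ≥0} (hl : 0 < l)
    (h : ∫⁻ x in Q.toSet, Ψ (‖f x‖₊ / l) ≤ volume Q.toSet) : luxemburg Ψ Q f ≤ l :=
  iInf_le_of_le l (iInf₂_le hl (laverage_le_one_iff.2 h))

lemma le_luxemburg {c : ℝ≥0∞} (h : ∀ l : ℝ≥0, 0 < l →
    ∫⁻ x in Q.toSet, Ψ (‖f x‖₊ / l) ≤ volume Q.toSet → c ≤ l) : c ≤ luxemburg Ψ Q f :=
  le_iInf fun l => le_iInf₂ fun hl h' => h l hl (laverage_le_one_iff.1 h')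

lemma aemeasurable_young_div (hmono : Monotone Ψ) (hf : AEMeasurable f) (l : ℝ≥0) :
    AEMeasurable fun x => Ψ (‖f x‖₊ / l) :=
  hmono.measurable.comp_aemeasurable (hf.nnnorm.div_const l)

/-- The easy half of Amemiya's formula: with `A` the mean of `Ψ(|f|/l)`, the number `l(1 + A)` is
admissible. Unlike the left side, the right side is additive over disjoint cubes. -/
lemma volume_mul_luxemburg_le (hsub : ∀ c : ℝ≥0, c ≤ 1 → ∀ t, Ψ (c * t) ≤ c * Ψ t)
    {l : ℝ≥0} (hl : 0 < l) :
    volume Q.toSet * luxemburg Ψ Q f ≤ l * ∫⁻ x in Q.toSet, (1 + Ψ (‖f x‖₊ / l)) := by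
  have hl' : (l : ℝ≥0∞) ≠ 0 := by simpa using hl.ne'
  set I := ∫⁻ x in Q.toSet, Ψ (‖f x‖₊ / l) with hI
  have h1 : ∫⁻ x in Q.toSet, (1 + Ψ (‖f x‖₊ / l)) = volume Q.toSet + I := by
    rw [lintegral_add_left measurable_const]
    simp [hI]
  rw [h1]
  by_cases htop : I = ∞
  · simp [htop, ENNReal.mul_top hl']
  set A : ℝ≥0 := (I / volume Q.toSet).toNNReal with hA
  have hAI : (A : ℝ≥0∞) * volume Q.toSet = I := by
    rw [hA, ENNReal.coe_toNNReal (ENNReal.div_ne_top htop Q.volume_ne_zero),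
      ENNReal.div_mul_cancel Q.volume_ne_zero Q.volume_ne_top]
  have hpos : 0 < 1 + A := by positivity
  have hle : luxemburg Ψ Q f ≤ ((l * (1 + A) : ℝ≥0) : ℝ≥0∞) := by
    refine luxemburg_le (by positivity) ?_
    calc ∫⁻ x in Q.toSet, Ψ (‖f x‖₊ / (l * (1 + A)))
        ≤ ∫⁻ x in Q.toSet, ((1 + A)⁻¹ : ℝ≥0) * Ψ (‖f x‖₊ / l) := by
          refine lintegral_mono fun x => ?_
          have := hsub (1 + A)⁻¹ (inv_le_one_of_one_le₀ le_self_add) (‖f x‖₊ / l)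
          refine le_trans (le_of_eq ?_) this
          congr 1
          field_simp
      _ = ((1 + A)⁻¹ : ℝ≥0) * I := by
          rw [lintegral_const_mul' _ _ ENNReal.coe_ne_top]
      _ = (((1 + A)⁻¹ * A : ℝ≥0) : ℝ≥0∞) * volume Q.toSet := by
          rw [ENNReal.coe_mul, mul_assoc, hAI]
      _ ≤ 1 * volume Q.toSet := by
          gcongr
          have : (1 + A)⁻¹ * A ≤ 1 := by
            rw [inv_mul_le_iff₀ hpos, mul_one]
            exact le_add_self
          exact_mod_cast this
      _ = _ := one_mul _
  calc volume Q.toSet * luxemburg Ψ Q f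
      ≤ volume Q.toSet * ((l * (1 + A) : ℝ≥0) : ℝ≥0∞) := by gcongr
    _ = l * (volume Q.toSet + A * volume Q.toSet) := by push_cast; ring
    _ = _ := by rw [hAI]

/-- Luxemburg averages over a tiling satisfy a Carleson condition. -/
lemma tsum_volume_mul_luxemburg_le
    (hsub : ∀ c : ℝ≥0, c ≤ 1 → ∀ t, Ψ (c * t) ≤ c * Ψ t)
    {𝒯 : Set (DyadicCube n)} (h𝒯 : IsTiling 𝒯) (R : DyadicCube n) :
    ∑' Q, {Q | Q ∈ 𝒯 ∧ Q.toSet ⊆ R.toSet}.indicator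
        (fun Q => volume Q.toSet * luxemburg Ψ Q f) Q
      ≤ 2 * (volume R.toSet * luxemburg Ψ R f) := by
  set 𝒮 := {Q | Q ∈ 𝒯 ∧ Q.toSet ⊆ R.toSet} with h𝒮
  rw [← tsum_subtype, ← mul_assoc]
  have hv0 : 2 * volume R.toSet ≠ 0 := mul_ne_zero two_ne_zero R.volume_ne_zero
  have hv : 2 * volume R.toSet ≠ ∞ := ENNReal.mul_ne_top ENNReal.ofNat_ne_top R.volume_ne_top
  rw [← ENNReal.div_le_iff' hv0 hv]
  -- One `l` admissible for `R` serves all tiles in `R` at once, although it need not be admissible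
  -- on each of them.
  refine le_luxemburg fun l hl hle => ?_
  rw [ENNReal.div_le_iff' hv0 hv]
  have hdisj : Pairwise (Function.onFun Disjoint fun Q : 𝒮 => (Q : DyadicCube n).toSet) := by
    intro Q Q' hne
    refine Set.disjoint_left.2 fun x hx hx' => hne ?_
    exact Subtype.ext (h𝒯.eq_of_mem Q.2.1 Q'.2.1 hx hx')
  calc ∑' Q : 𝒮, volume (Q : DyadicCube n).toSet * luxemburg Ψ Q f
      ≤ ∑' Q : 𝒮, l * ∫⁻ x in (Q : DyadicCube n).toSet, (1 + Ψ (‖f x‖₊ / l)) :=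
        ENNReal.tsum_le_tsum fun Q => volume_mul_luxemburg_le hsub hl
    _ = l * ∫⁻ x in ⋃ Q : 𝒮, (Q : DyadicCube n).toSet, (1 + Ψ (‖f x‖₊ / l)) := by
        rw [ENNReal.tsum_mul_left, lintegral_iUnion (fun Q => measurableSet_toSet _) hdisj]
    _ ≤ l * ∫⁻ x in R.toSet, (1 + Ψ (‖f x‖₊ / l)) := by
        gcongr
        exact Set.iUnion_subset fun Q => Q.2.2
    _ ≤ l * (volume R.toSet + volume R.toSet) := by
        rw [lintegral_add_left measurable_const]
        gcongr
        simp
    _ = _ := by ring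

lemma lintegral_le_mul_luxemburg {s₀ : ℝ≥0}
    (hs₀ : ∀ s : ℝ≥0, (s : ℝ≥0∞) ≤ s₀ * (1 + Ψ s)) :
    ∫⁻ x in Q.toSet, ‖f x‖ₑ ≤ 2 * (s₀ + 1) * volume Q.toSet * luxemburg Ψ Q f := by
  have hv0 : 2 * ((s₀ : ℝ≥0∞) + 1) * volume Q.toSet ≠ 0 :=
    mul_ne_zero (mul_ne_zero two_ne_zero (by simp)) Q.volume_ne_zero
  have hv : 2 * ((s₀ : ℝ≥0∞) + 1) * volume Q.toSet ≠ ∞ :=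
    ENNReal.mul_ne_top (ENNReal.mul_ne_top ENNReal.ofNat_ne_top (by simp)) Q.volume_ne_top
  rw [← ENNReal.div_le_iff' hv0 hv]
  refine le_luxemburg fun l hl hle => ?_
  rw [ENNReal.div_le_iff' hv0 hv]
  calc ∫⁻ x in Q.toSet, ‖f x‖ₑ
      ≤ ∫⁻ x in Q.toSet, (l * (s₀ + 1 : ℝ≥0) : ℝ≥0) * (1 + Ψ (‖f x‖₊ / l)) := by
        refine lintegral_mono fun x => ?_
        calc ‖f x‖ₑ = l * ((‖f x‖₊ / l : ℝ≥0) : ℝ≥0∞) := by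
              rw [← ENNReal.coe_mul, mul_div_cancel₀ _ hl.ne']; rfl
          _ ≤ l * ((s₀ + 1 : ℝ≥0) * (1 + Ψ (‖f x‖₊ / l))) := by
              gcongr
              refine (hs₀ _).trans ?_
              gcongr
              exact le_self_add
          _ = _ := by push_cast; ring
    _ = (l * (s₀ + 1 : ℝ≥0) : ℝ≥0) * (volume Q.toSet + ∫⁻ x in Q.toSet, Ψ (‖f x‖₊ / l)) := by
        rw [lintegral_const_mul' _ _ ENNReal.coe_ne_top, lintegral_add_left measurable_const]
        simp
    _ ≤ (l * (s₀ + 1 : ℝ≥0) : ℝ≥0) * (volume Q.toSet + volume Q.toSet) := by gcongr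
    _ = _ := by push_cast; ring

lemma lintegral_mul_le_of_luxemburg_eq_zero {s₀ : ℝ≥0}
    (hs₀ : ∀ s : ℝ≥0, (s : ℝ≥0∞) ≤ s₀ * (1 + Ψ s)) (hf : AEMeasurable f)
    (h0 : luxemburg Ψ Q f = 0) : ∫⁻ x in Q.toSet, ‖f x * g x‖ₑ = 0 := by
  have h := lintegral_le_mul_luxemburg hs₀ (Q := Q) (f := f)
  rw [h0, mul_zero, nonpos_iff_eq_zero, lintegral_eq_zero_iff' hf.restrict.enorm] at h
  rw [lintegral_congr_ae (g := fun _ => 0)]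
  · simp
  filter_upwards [h] with x hx
  have : f x = 0 := by simpa using hx
  simp [this]

/-- Hölder's inequality for Luxemburg averages. -/
lemma lintegral_mul_le_luxemburg {Φ : ℝ≥0 → ℝ≥0∞} (hΦ : IsYoung Φ) (hfin : ∀ t, Φ t ≠ ∞)
    (hf : AEMeasurable f) (hg : AEMeasurable g) :
    ∫⁻ x in Q.toSet, ‖f x * g x‖ₑ
      ≤ 2 * (volume Q.toSet * (luxemburg Φ Q f * luxemburg (complementary Φ) Q g)) := by
  obtain ⟨s₀, hs₀⟩ := hΦ.exists_le_mul_one_add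
  obtain ⟨s₁, hs₁⟩ := exists_le_mul_one_add_complementary hfin
  -- If one average vanishes, the integral vanishes too, so the convention `0 * ∞ = 0` does no harm.
  rcases eq_or_ne (luxemburg Φ Q f) 0 with ha | ha
  · rw [lintegral_mul_le_of_luxemburg_eq_zero hs₀ hf ha]
    exact zero_le
  rcases eq_or_ne (luxemburg (complementary Φ) Q g) 0 with hb | hb
  · simp_rw [mul_comm (f _)]
    rw [lintegral_mul_le_of_luxemburg_eq_zero hs₁ hg hb]
    exact zero_le
  rcases eq_or_ne (luxemburg Φ Q f) ∞ with ha' | ha'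
  · rw [ha', ENNReal.top_mul hb, ENNReal.mul_top Q.volume_ne_zero]
    simp
  have hv0 : 2 * volume Q.toSet ≠ 0 := mul_ne_zero two_ne_zero Q.volume_ne_zero
  have hv : 2 * volume Q.toSet ≠ ∞ := ENNReal.mul_ne_top ENNReal.ofNat_ne_top Q.volume_ne_top
  set I := ∫⁻ x in Q.toSet, ‖f x * g x‖ₑ with hI
  rw [← mul_assoc, ← mul_assoc,
    ← ENNReal.div_le_iff' (mul_ne_zero hv0 ha) (ENNReal.mul_ne_top hv ha')]
  refine le_luxemburg fun l' hl' hle' => ?_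
  have hl'0 : (l' : ℝ≥0∞) ≠ 0 := by simpa using hl'.ne'
  rw [ENNReal.div_le_iff' (mul_ne_zero hv0 ha) (ENNReal.mul_ne_top hv ha'),
    mul_right_comm,
    ← ENNReal.div_le_iff' (mul_ne_zero hv0 hl'0) (ENNReal.mul_ne_top hv ENNReal.coe_ne_top)]
  refine le_luxemburg fun l hl hle => ?_
  rw [ENNReal.div_le_iff' (mul_ne_zero hv0 hl'0) (ENNReal.mul_ne_top hv ENNReal.coe_ne_top)]
  calc I ≤ ∫⁻ x in Q.toSet, (l' * l : ℝ≥0) *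
          (Φ (‖f x‖₊ / l) + complementary Φ (‖g x‖₊ / l')) := by
        refine lintegral_mono fun x => ?_
        calc ‖f x * g x‖ₑ
            = (l' * l : ℝ≥0) * (((‖f x‖₊ / l : ℝ≥0) : ℝ≥0∞) * ((‖g x‖₊ / l' : ℝ≥0) : ℝ≥0∞)) := by
              rw [enorm_mul, ← ENNReal.coe_mul, ← ENNReal.coe_mul]
              rw [enorm_eq_nnnorm, enorm_eq_nnnorm, ← ENNReal.coe_mul]
              congr 1
              field_simp
          _ ≤ _ := by
              gcongr
              exact mul_le_add_complementary Φ _ _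
    _ = (l' * l : ℝ≥0) * ((∫⁻ x in Q.toSet, Φ (‖f x‖₊ / l))
          + ∫⁻ x in Q.toSet, complementary Φ (‖g x‖₊ / l')) := by
        rw [lintegral_const_mul' _ _ ENNReal.coe_ne_top,
          lintegral_add_left' (aemeasurable_young_div hΦ.monotone hf l).restrict]
    _ ≤ (l' * l : ℝ≥0) * (volume Q.toSet + volume Q.toSet) := by gcongr
    _ = _ := by push_cast; ring

lemma luxemburg_eq_zero (hΨ : Ψ 0 = 0) (h : ∀ x ∈ Q.toSet, f x = 0) : luxemburg Ψ Q f = 0 := by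
  refine le_antisymm (ENNReal.le_of_forall_pos_le_add fun ε hε _ => ?_) zero_le
  rw [zero_add]
  refine luxemburg_le hε ?_
  rw [setLIntegral_congr_fun Q.measurableSet_toSet (g := fun _ => 0) fun x hx => by
    simp [h x hx, hΨ]]
  simp

lemma luxemburg_congr (h : ∀ x ∈ Q.toSet, f x = g x) : luxemburg Ψ Q f = luxemburg Ψ Q g := by
  refine iInf_congr fun l => iInf_congr fun _ => ?_
  rw [laverage_eq, laverage_eq, setLIntegral_congr_fun Q.measurableSet_toSet
    (g := fun x => Ψ (‖g x‖₊ / l)) fun x hx => by simp [h x hx]]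

lemma luxemburg_const_mul_le (hΨ : Ψ 0 = 0) (c : ℝ≥0) :
    luxemburg Ψ Q (fun x => c * f x) ≤ c * luxemburg Ψ Q f := by
  rcases eq_or_ne c 0 with rfl | hc
  · rw [luxemburg_eq_zero hΨ (by simp)]
    exact zero_le
  have hc' : (c : ℝ≥0∞) ≠ 0 := by simpa using hc
  rw [← ENNReal.div_le_iff' hc' ENNReal.coe_ne_top]
  refine le_luxemburg fun l hl hle => ?_
  rw [ENNReal.div_le_iff' hc' ENNReal.coe_ne_top, ← ENNReal.coe_mul]
  refine luxemburg_le (by positivity) (le_trans (le_of_eq ?_) hle)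
  refine lintegral_congr fun x => congrArg Ψ ?_
  rw [nnnorm_mul, NNReal.nnnorm_eq]
  field_simp

/-- The Luxemburg average is dominated by the dual (Orlicz) average. -/
lemma exists_dual_of_lt_luxemburg {Φ : ℝ≥0 → ℝ≥0∞} (hΦ : IsYoung Φ) (hΔ : Delta2 Φ)
    (hf : AEMeasurable f) {l : ℝ≥0} (hl : l = 0 ∨ (l : ℝ≥0∞) < luxemburg Φ Q f) :
    ∃ g : (Fin n → ℝ) → ℝ, AEMeasurable g ∧ luxemburg (complementary Φ) Q g ≤ 1 ∧
      l * volume Q.toSet ≤ ∫⁻ x in Q.toSet, ‖f x * g x‖ₑ := by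
  rcases eq_or_ne l 0 with rfl | hl0
  · exact ⟨0, aemeasurable_const, by rw [luxemburg_eq_zero (by simp) (by simp)]; simp, by simp⟩
  replace hl := hl.resolve_left hl0
  have hlpos : 0 < l := pos_iff_ne_zero.2 hl0
  have hbig : volume Q.toSet < ∫⁻ x in Q.toSet, Φ (‖f x‖₊ / l) :=
    not_le.1 fun h => not_le.2 hl (luxemburg_le hlpos h)
  rcases hΔ.finite_or_top hΦ with hfin | htop
  -- Truncation makes the modular finite; `N` is chosen so that the mean `V` of `Φ(h)` is still at
  -- least `1`. For `g = V⁻¹ Φ(h)/h` one has `Φ̄(g) ≤ V⁻¹ Φ(h)`, of mean `1`, and `|f| g ≥ l h g = l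
  -- V⁻¹ Φ(h)`, of mean `l`.
  · set h : ℕ → (Fin n → ℝ) → ℝ≥0 := fun N x => min (‖f x‖₊ / l) N with hh
    have hm : ∀ N, AEMeasurable (h N) := fun N => (hf.nnnorm.div_const l).min aemeasurable_const
    have hsup : ∀ x, ⨆ N, Φ (h N x) = Φ (‖f x‖₊ / l) := by
      intro x
      refine le_antisymm (iSup_le fun N => hΦ.monotone (min_le_left _ _)) ?_
      obtain ⟨N, hN⟩ := exists_nat_ge (‖f x‖₊ / l)
      refine le_iSup_of_le N ?_
      simp only [hh, min_eq_left hN, le_refl]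
    have hΦm : ∀ N, AEMeasurable fun x => Φ (h N x) :=
      fun N => hΦ.monotone.measurable.comp_aemeasurable (hm N)
    simp_rw [← hsup] at hbig
    rw [lintegral_iSup' (fun N => (hΦm N).restrict)
      (ae_of_all _ fun x i j hij => hΦ.monotone (min_le_min_left _ (by exact_mod_cast hij))),
      lt_iSup_iff] at hbig
    obtain ⟨N, hN⟩ := hbig
    set I := ∫⁻ x in Q.toSet, Φ (h N x) with hI
    have hItop : I ≠ ∞ := by
      refine ne_top_of_le_ne_top (ENNReal.mul_ne_top (hfin N) Q.volume_ne_top)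
        ((lintegral_mono fun x => hΦ.monotone (min_le_right _ _)).trans_eq ?_)
      rw [setLIntegral_const]
    set V : ℝ≥0 := (I / volume Q.toSet).toNNReal with hV
    have hVI : (V : ℝ≥0∞) * volume Q.toSet = I := by
      rw [hV, ENNReal.coe_toNNReal (ENNReal.div_ne_top hItop Q.volume_ne_zero),
        ENNReal.div_mul_cancel Q.volume_ne_zero Q.volume_ne_top]
    have hV1 : 1 ≤ V := by
      by_contra! hlt
      refine absurd hN (not_lt.2 ?_)
      rw [← hVI]
      exact mul_le_of_le_one_left zero_le (by exact_mod_cast hlt.le)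
    have hV0 : V ≠ 0 := (zero_lt_one.trans_le hV1).ne'
    have hVinv : (V⁻¹ : ℝ≥0) * I = volume Q.toSet := by
      rw [← hVI, ← mul_assoc, ← ENNReal.coe_mul, inv_mul_cancel₀ hV0]
      simp
    set g₀ : (Fin n → ℝ) → ℝ≥0 := fun x => V⁻¹ * ((Φ (h N x)).toNNReal / h N x) with hg₀
    refine ⟨fun x => g₀ x, ?_, ?_, ?_⟩
    · exact ((((hΦm N).ennreal_toNNReal).div (hm N)).const_mul _).coe_nnreal_real
    · refine (luxemburg_le one_pos ?_).trans_eq ENNReal.coe_one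
      calc ∫⁻ x in Q.toSet, complementary Φ (‖(g₀ x : ℝ)‖₊ / 1)
          ≤ ∫⁻ x in Q.toSet, (V⁻¹ : ℝ≥0) * Φ (h N x) := by
            refine lintegral_mono fun x => ?_
            rw [NNReal.nnnorm_eq, div_one]
            refine (complementary_mul_le (inv_le_one_of_one_le₀ hV1) _).trans ?_
            gcongr
            exact complementary_div_self_le hΦ hfin _
        _ = volume Q.toSet := by
            rw [lintegral_const_mul' _ _ ENNReal.coe_ne_top, hVinv]
        _ ≤ _ := le_rfl
    · calc l * volume Q.toSet = ∫⁻ x in Q.toSet, (l * V⁻¹ : ℝ≥0) * Φ (h N x) := by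
            rw [lintegral_const_mul' _ _ ENNReal.coe_ne_top, ENNReal.coe_mul, mul_assoc, hVinv]
        _ ≤ ∫⁻ x in Q.toSet, ‖f x * g₀ x‖ₑ := by
            refine lintegral_mono fun x => ?_
            rw [enorm_mul, enorm_eq_nnnorm, enorm_eq_nnnorm, NNReal.nnnorm_eq, ← ENNReal.coe_mul]
            rcases eq_or_ne (h N x) 0 with h0 | h0
            · simp [h0, hΦ.map_zero]
            rw [← ENNReal.coe_toNNReal (hfin (h N x)), ← ENNReal.coe_mul, ENNReal.coe_le_coe]
            have hle : l * h N x ≤ ‖f x‖₊ := by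
              rw [mul_comm, ← le_div_iff₀ hlpos]
              exact min_le_left _ _
            calc l * V⁻¹ * (Φ (h N x)).toNNReal = l * h N x * g₀ x := by
                  simp only [hg₀]
                  field_simp
              _ ≤ _ := by gcongr
  · have hI0 : ∫⁻ x in Q.toSet, ‖f x‖ₑ ≠ 0 := by
      intro h0
      rw [lintegral_eq_zero_iff' hf.restrict.enorm] at h0
      rw [lintegral_congr_ae (g := fun _ => 0)] at hbig
      · simp at hbig
      filter_upwards [h0] with x hx
      have : f x = 0 := by simpa using hx
      simp [this, hΦ.map_zero]
    -- Here the complementary function vanishes, so every `g` is admissible and a large constant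
    -- suffices.
    have hcomp : ∀ t, complementary Φ t = 0 := by
      intro t
      refine le_antisymm (iSup_le fun s => ?_) zero_le
      rcases eq_or_ne s 0 with rfl | hs
      · simp
      · simp [htop s hs]
    have hlux : ∀ g : (Fin n → ℝ) → ℝ, luxemburg (complementary Φ) Q g ≤ 1 := fun g =>
      (luxemburg_le one_pos (by simp [hcomp])).trans_eq ENNReal.coe_one
    obtain ⟨m, hm⟩ : ∃ m : ℕ, l * volume Q.toSet ≤ m * ∫⁻ x in Q.toSet, ‖f x‖ₑ := by
      obtain ⟨m, hm⟩ := ENNReal.exists_nat_mul_gt hI0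
        (ENNReal.mul_ne_top ENNReal.coe_ne_top Q.volume_ne_top : l * volume Q.toSet ≠ ∞)
      exact ⟨m, hm.le⟩
    refine ⟨fun _ => m, aemeasurable_const, hlux _, hm.trans_eq ?_⟩
    rw [← lintegral_const_mul' _ _ (ENNReal.natCast_ne_top m)]
    refine lintegral_congr fun x => ?_
    rw [enorm_mul, mul_comm]
    simp

/-! ### The Orlicz-Morrey norm and the block norm -/

@[simp] lemma choquetNorm_one (d : ℝ) (F : (Fin n → ℝ) → ℝ≥0∞) :
    choquetNorm d 1 F = choquetIntegral d F := by
  simp [choquetNorm]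

lemma choquetNorm_of_ne_top (d : ℝ) {q : ℝ≥0∞} (hq : q ≠ ∞) (F : (Fin n → ℝ) → ℝ≥0∞) :
    choquetNorm d q F = choquetIntegral d (fun x => F x ^ q.toReal) ^ (q.toReal)⁻¹ := by
  simp [choquetNorm, hq]

lemma le_of_choquetNorm_top_le {d : ℝ} (hd : 0 < d) (hdn : d < n) {F : (Fin n → ℝ) → ℝ≥0∞}
    {R : DyadicCube n} {b : ℝ≥0∞} (hb : ∀ x ∈ R.toSet, b ≤ F x) :
    b ≤ choquetNorm d ∞ F := by
  rw [choquetNorm, if_pos rfl]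
  refine le_iInf fun t => le_iInf₂ fun _ h0 => ?_
  by_contra! hlt
  have := le_hausdorffContent hd hdn (Q := R) (E := {x | (t : ℝ≥0∞) < F x})
    fun x hx => lt_of_lt_of_le hlt (hb x hx)
  rw [h0, nonpos_iff_eq_zero] at this
  exact R.side_rpow_ne_zero d this

lemma choquetNorm_top_le_one {d : ℝ} {F : (Fin n → ℝ) → ℝ≥0∞} (h : ∀ x, F x ≤ 1) :
    choquetNorm d ∞ F ≤ 1 := by
  rw [choquetNorm, if_pos rfl]
  have h0 : {x | ((1 : ℝ≥0) : ℝ≥0∞) < F x} = ∅ := by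
    ext x; simpa using h x
  exact iInf_le_of_le 1 (iInf₂_le one_pos (by rw [h0]; simp))

lemma blockNorm_eq (d : ℝ) (p : ℝ≥0∞) (Φ : ℝ≥0 → ℝ≥0∞) (𝒯 : Set (DyadicCube n))
    (f : (Fin n → ℝ) → ℝ) : blockNorm d p Φ 𝒯 f
      = choquetIntegral d (tileSum 𝒯 fun Q => luxemburg Φ Q f ^ p.toReal) ^ (p.toReal)⁻¹ := by
  rw [blockNorm, choquetNorm_one]

lemma le_maximal (α : ℝ) (Φ : ℝ≥0 → ℝ≥0∞) (f : (Fin n → ℝ) → ℝ) {Q : DyadicCube n}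
    {x : Fin n → ℝ} (hx : x ∈ Q.toSet) :
    (Q.side : ℝ≥0∞) ^ α * luxemburg Φ Q f ≤ maximal α Φ f x := by
  refine le_iSup_of_le Q ?_
  rw [Set.indicator_of_mem hx]

/-- A discrete Hölder inequality: the Carleson embedding with conjugate exponents. -/
lemma tsum_mul_le_of_carleson {d : ℝ} (hd : 0 < d) (hdn : d < n)
    {𝒯 : Set (DyadicCube n)} (h𝒯 : IsTiling 𝒯) {a b : DyadicCube n → ℝ≥0∞}
    (hcar : ∀ R : DyadicCube n, ∑' Q, {Q | Q ∈ 𝒯 ∧ Q.toSet ⊆ R.toSet}.indicator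
      (fun Q => (Q.side : ℝ≥0∞) ^ d * b Q) Q ≤ 2 * ((R.side : ℝ≥0∞) ^ d * b R))
    {p q : ℝ} (hpq : p.HolderConjugate q) {M : (Fin n → ℝ) → ℝ≥0∞}
    (hbM : ∀ R : DyadicCube n, ∀ x ∈ R.toSet, b R ≤ M x)
    (hM : choquetIntegral d (fun x => M x ^ q) ≤ 1) :
    ∑' Q : 𝒯, ((Q : DyadicCube n).side : ℝ≥0∞) ^ d * (a Q * b Q)
      ≤ 24 * choquetIntegral d (tileSum 𝒯 fun Q => a Q ^ p) ^ p⁻¹ := by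
  have hp := hpq.pos
  have hq := hpq.symm.pos
  set I := choquetIntegral d (tileSum 𝒯 fun Q => a Q ^ p) with hI
  rcases eq_or_ne I 0 with h0 | h0
  · have ha : ∀ Q ∈ 𝒯, a Q = 0 := by
      intro Q hQ
      have := mul_le_choquetIntegral hd hdn (Q := Q) (F := tileSum 𝒯 fun Q => a Q ^ p)
        (a := a Q ^ p) fun x hx => (tileSum_apply h𝒯 _ hQ hx).ge
      rw [← hI, h0, nonpos_iff_eq_zero, mul_eq_zero] at this
      exact (ENNReal.rpow_eq_zero_iff_of_pos hp).1 (this.resolve_left (Q.side_rpow_ne_zero d))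
    have : ∀ Q : 𝒯, ((Q : DyadicCube n).side : ℝ≥0∞) ^ d * (a Q * b Q) = 0 := by
      intro Q
      simp [ha Q Q.2]
    simp [this]
  rcases eq_or_ne I ∞ with htop | htop
  · rw [htop, ENNReal.top_rpow_of_pos (by positivity), ENNReal.mul_top (by norm_num)]
    exact le_top
  have hi0 : I.toNNReal ≠ 0 := by simp [ENNReal.toNNReal_eq_zero_iff, h0, htop]
  have hiI : (I.toNNReal : ℝ≥0∞) = I := ENNReal.coe_toNNReal htop
  set i : ℝ≥0 := I.toNNReal with hi
  -- Rescaling `a` by `I^(-1/p)` gives both functions in the maximum a Choquet integral of at most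
  -- `1`; hence the factor `12 * 2 = 24`.
  set c : ℝ≥0 := i⁻¹ ^ p⁻¹ with hc
  have hcp : (c : ℝ≥0∞) ^ p = ((i⁻¹ : ℝ≥0) : ℝ≥0∞) := by
    rw [← ENNReal.coe_rpow_of_nonneg _ hp.le, hc, NNReal.rpow_inv_rpow hp.ne']
  have key := tsum_le_choquetIntegral_of_carleson hd hdn h𝒯 (a := fun Q => c * a Q) hcar
    (G := fun x => max (((i⁻¹ : ℝ≥0) : ℝ≥0∞) * tileSum 𝒯 (fun Q => a Q ^ p) x) (M x ^ q)) (by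
      intro Q hQ R hQR x hx
      rw [tileSum_apply h𝒯 _ hQ hx, ← hcp, ← ENNReal.mul_rpow_of_nonneg _ _ hp.le]
      set m := max ((c * a Q) ^ p) (M x ^ q) with hm
      have h1 : c * a Q ≤ m ^ p⁻¹ := by
        rw [ENNReal.le_rpow_inv_iff hp]; exact le_max_left _ _
      have h2 : b R ≤ m ^ q⁻¹ := by
        rw [ENNReal.le_rpow_inv_iff hq]
        exact (ENNReal.rpow_le_rpow (hbM R x (hQR hx)) hq.le).trans (le_max_right _ _)
      refine (mul_le_mul' h1 h2).trans_eq ?_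
      rw [← ENNReal.rpow_add_of_nonneg _ _ (by positivity) (by positivity),
        hpq.inv_add_inv_eq_one, ENNReal.rpow_one])
  have hG := (choquetIntegral_max_le d
    (fun x => ((i⁻¹ : ℝ≥0) : ℝ≥0∞) * tileSum 𝒯 (fun Q => a Q ^ p) x) (fun x => M x ^ q)).trans
    (add_le_add le_rfl hM)
  rw [choquetIntegral_const_mul (inv_ne_zero hi0), ← hI, ← hiI, ← ENNReal.coe_mul,
    inv_mul_cancel₀ hi0, ENNReal.coe_one, one_add_one_eq_two] at hG
  have h24 : (c : ℝ≥0∞) * ∑' Q : 𝒯, ((Q : DyadicCube n).side : ℝ≥0∞) ^ d * (a Q * b Q) ≤ 24 := by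
    calc _ = ∑' Q : 𝒯, ((Q : DyadicCube n).side : ℝ≥0∞) ^ d * (c * a Q * b Q) := by
          rw [← ENNReal.tsum_mul_left]
          exact tsum_congr fun Q => by ring
      _ ≤ 12 * 2 := key.trans (by gcongr)
      _ = 24 := by norm_num
  have hcinv : ((i ^ p⁻¹ : ℝ≥0) : ℝ≥0∞) * c = 1 := by
    rw [← ENNReal.coe_mul, hc, ← NNReal.mul_rpow, mul_inv_cancel₀ hi0]
    simp
  calc ∑' Q : 𝒯, ((Q : DyadicCube n).side : ℝ≥0∞) ^ d * (a Q * b Q)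
      = ((i ^ p⁻¹ : ℝ≥0) : ℝ≥0∞) *
          (c * ∑' Q : 𝒯, ((Q : DyadicCube n).side : ℝ≥0∞) ^ d * (a Q * b Q)) := by
        rw [← mul_assoc, hcinv, one_mul]
    _ ≤ ((i ^ p⁻¹ : ℝ≥0) : ℝ≥0∞) * 24 := by gcongr
    _ = 24 * I ^ p⁻¹ := by
        rw [ENNReal.coe_rpow_of_nonneg _ (by positivity), hiI, mul_comm]

lemma lintegral_eq_tsum_tiling {𝒯 : Set (DyadicCube n)} (h𝒯 : IsTiling 𝒯)
    (F : (Fin n → ℝ) → ℝ≥0∞) :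
    ∫⁻ x, F x = ∑' Q : 𝒯, ∫⁻ x in (Q : DyadicCube n).toSet, F x := by
  have hcov : (⋃ Q : 𝒯, (Q : DyadicCube n).toSet) = Set.univ := by
    refine Set.eq_univ_of_forall fun x => ?_
    obtain ⟨Q, ⟨hQ, hx⟩, -⟩ := h𝒯 x
    exact Set.mem_iUnion.2 ⟨⟨Q, hQ⟩, hx⟩
  rw [← setLIntegral_univ, ← hcov, lintegral_iUnion (fun Q => measurableSet_toSet _)]
  intro Q Q' hne
  refine Set.disjoint_left.2 fun x hx hx' => hne ?_
  exact Subtype.ext (h𝒯.eq_of_mem Q.2 Q'.2 hx hx')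

lemma blockNorm_eq_top {d : ℝ} (hd : 0 < d) (hdn : d < n) {p : ℝ≥0∞} (hp : 0 < p.toReal)
    {Φ : ℝ≥0 → ℝ≥0∞} {𝒯 : Set (DyadicCube n)} (h𝒯 : IsTiling 𝒯) {f : (Fin n → ℝ) → ℝ}
    {Q : DyadicCube n} (hQ : Q ∈ 𝒯) (h : luxemburg Φ Q f = ∞) : blockNorm d p Φ 𝒯 f = ∞ := by
  have := mul_le_choquetIntegral hd hdn (Q := Q)
    (F := tileSum 𝒯 fun Q => luxemburg Φ Q f ^ p.toReal) (a := ∞) fun x hx => by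
      rw [tileSum_apply h𝒯 _ hQ hx, h, ENNReal.top_rpow_of_pos hp]
  rw [ENNReal.mul_top (Q.side_rpow_ne_zero d), top_le_iff] at this
  rw [blockNorm_eq, this, ENNReal.top_rpow_of_pos (by positivity)]

/-- For a Young function with values in `{0, ∞}` jumping at the origin, the Luxemburg average is
`0` or `∞`. -/
lemma luxemburg_eq_zero_of_ne_top {Φ : ℝ≥0 → ℝ≥0∞} (htop : ∀ t, t ≠ 0 → Φ t = ∞)
    {Q : DyadicCube n} {f : (Fin n → ℝ) → ℝ} (h : luxemburg Φ Q f ≠ ∞) :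
    luxemburg Φ Q f = 0 := by
  have hconst : ∀ l l' s : ℝ≥0, 0 < l → 0 < l' → Φ (s / l) = Φ (s / l') := by
    intro l l' s hl hl'
    rcases eq_or_ne s 0 with rfl | hs
    · simp
    · rw [htop _ (div_ne_zero hs hl.ne'), htop _ (div_ne_zero hs hl'.ne')]
  obtain ⟨l, hl, hle⟩ : ∃ l : ℝ≥0, 0 < l ∧
      ∫⁻ x in Q.toSet, Φ (‖f x‖₊ / l) ≤ volume Q.toSet := by
    by_contra! hno
    exact h (top_le_iff.1 (le_luxemburg fun l hl hle => absurd hle (not_le.2 (hno l hl))))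
  refine le_antisymm (ENNReal.le_of_forall_pos_le_add fun ε hε _ => ?_) zero_le
  rw [zero_add]
  refine luxemburg_le hε (le_trans (le_of_eq ?_) hle)
  exact lintegral_congr fun x => hconst _ _ _ hε hl

/-- Hölder on each tile costs `2` and the Carleson embedding `24`. -/
lemma lintegral_mul_le_blockNorm {d : ℝ} (hd : 0 < d) (hdn : d < n) {p q : ℝ≥0∞} (hp : 1 ≤ p)
    (hp_top : p ≠ ∞) (hpq : p.HolderConjugate q) {Φ : ℝ≥0 → ℝ≥0∞} (hΦ : IsYoung Φ)
    (hΔ : Delta2 Φ) {𝒯 : Set (DyadicCube n)} (h𝒯 : IsTiling 𝒯) {f g : (Fin n → ℝ) → ℝ}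
    (hf : AEMeasurable f) (hg : AEMeasurable g)
    (hg1 : morreyNorm d q (complementary Φ) g ≤ 1) :
    ∫⁻ x, ‖f x * g x‖ₑ ≤ 48 * blockNorm d p Φ 𝒯 f := by
  have hp0 : 0 < p.toReal := ENNReal.toReal_pos (zero_lt_one.trans_le hp).ne' hp_top
  rw [lintegral_eq_tsum_tiling h𝒯]
  rcases hΔ.finite_or_top hΦ with hfin | htop
  swap
  -- For `Φ` infinite off the origin Hölder's inequality may fail as `∞ * 0`. But then the averages
  -- of `f` are `0` or `∞`: either `f` vanishes almost everywhere, or the block norm is infinite.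
  · by_cases hex : ∃ Q ∈ 𝒯, luxemburg Φ Q f = ∞
    · obtain ⟨Q, hQ, hlux⟩ := hex
      rw [blockNorm_eq_top hd hdn hp0 h𝒯 hQ hlux, ENNReal.mul_top (by norm_num)]
      exact le_top
    · push Not at hex
      obtain ⟨s₀, hs₀⟩ := hΦ.exists_le_mul_one_add
      have : ∀ Q : 𝒯, ∫⁻ x in (Q : DyadicCube n).toSet, ‖f x * g x‖ₑ = 0 := fun Q =>
        lintegral_mul_le_of_luxemburg_eq_zero hs₀ hf
          (luxemburg_eq_zero_of_ne_top htop (hex Q Q.2))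
      rw [ENNReal.tsum_eq_zero.2 this]
      exact zero_le
  set a : DyadicCube n → ℝ≥0∞ := fun Q => luxemburg Φ Q f with ha
  set b : DyadicCube n → ℝ≥0∞ := fun Q =>
    (Q.side : ℝ≥0∞) ^ ((n : ℝ) - d) * luxemburg (complementary Φ) Q g with hb
  have hvol : ∀ (Q : DyadicCube n) (t : ℝ≥0∞), volume Q.toSet * t
      = (Q.side : ℝ≥0∞) ^ d * ((Q.side : ℝ≥0∞) ^ ((n : ℝ) - d) * t) := by
    intro Q t
    rw [← mul_assoc, ← side_rpow_add, volume_toSet]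
    congr 2; ring
  have hcar : ∀ R : DyadicCube n, ∑' Q, {Q | Q ∈ 𝒯 ∧ Q.toSet ⊆ R.toSet}.indicator
      (fun Q => (Q.side : ℝ≥0∞) ^ d * b Q) Q ≤ 2 * ((R.side : ℝ≥0∞) ^ d * b R) := by
    intro R
    have := tsum_volume_mul_luxemburg_le (Ψ := complementary Φ) (f := g)
      (fun c hc t => complementary_mul_le hc t) h𝒯 R
    simpa only [hvol] using this
  have hbM : ∀ R : DyadicCube n, ∀ x ∈ R.toSet,
      b R ≤ maximal ((n : ℝ) - d) (complementary Φ) g x := fun R x hx => le_maximal _ _ _ hx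
  have hsum : ∑' Q : 𝒯, ∫⁻ x in (Q : DyadicCube n).toSet, ‖f x * g x‖ₑ
      ≤ 2 * ∑' Q : 𝒯, ((Q : DyadicCube n).side : ℝ≥0∞) ^ d * (a Q * b Q) := by
    rw [← ENNReal.tsum_mul_left]
    refine ENNReal.tsum_le_tsum fun Q => ?_
    refine (lintegral_mul_le_luxemburg hΦ hfin hf hg).trans_eq ?_
    rw [hvol]
    simp only [ha, hb]
    ring
  suffices h : ∑' Q : 𝒯, ((Q : DyadicCube n).side : ℝ≥0∞) ^ d * (a Q * b Q)
      ≤ 24 * blockNorm d p Φ 𝒯 f by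
    calc _ ≤ 2 * (24 * blockNorm d p Φ 𝒯 f) := hsum.trans (by gcongr)
      _ = _ := by rw [← mul_assoc]; norm_num
  rw [blockNorm_eq]
  rcases eq_or_ne q ∞ with hq | hq
  · have hp1 : p = 1 := (ENNReal.HolderConjugate.eq_top_iff_eq_one q p).1 hq
    -- A nonempty cube has positive content, so the essential bound on the maximal function holds
    -- for `b R` on every dyadic cube.
    have hb1 : ∀ R, b R ≤ 1 := fun R =>
      (le_of_choquetNorm_top_le hd hdn (hbM R)).trans (by rw [← hq]; exact hg1)
    have := tsum_le_choquetIntegral_of_carleson hd hdn h𝒯 (a := a) hcar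
      (G := tileSum 𝒯 a) (fun Q hQ R _ x hx => by
        rw [tileSum_apply h𝒯 _ hQ hx]
        exact mul_le_of_le_one_right zero_le (hb1 R))
    refine this.trans ?_
    simp only [hp1, ENNReal.toReal_one, ENNReal.rpow_one, inv_one]
    gcongr
    norm_num
  · have hpq' : p.toReal.HolderConjugate q.toReal :=
      ENNReal.HolderConjugate.toReal_of_ne_top hp_top hq
    refine tsum_mul_le_of_carleson hd hdn h𝒯 hcar hpq' hbM ?_
    rw [morreyNorm, choquetNorm_of_ne_top d hq, ENNReal.rpow_inv_le_iff hpq'.symm.pos,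
      ENNReal.one_rpow] at hg1
    exact hg1

/-! ### The lower bound -/

/-- Gluing local extremals over finitely many tiles. -/
lemma sum_le_associateNorm {d : ℝ} {Φ : ℝ≥0 → ℝ≥0∞} (hΦ : IsYoung Φ)
    (hΔ : Delta2 Φ) {𝒯 : Set (DyadicCube n)} (h𝒯 : IsTiling 𝒯) {f : (Fin n → ℝ) → ℝ}
    (hf : AEMeasurable f) {F : Finset (DyadicCube n)} (hF : ∀ Q ∈ F, Q ∈ 𝒯)
    {l b : DyadicCube n → ℝ≥0} (hl : ∀ Q ∈ F, l Q = 0 ∨ (l Q : ℝ≥0∞) < luxemburg Φ Q f)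
    {ρ : ((Fin n → ℝ) → ℝ) → ℝ≥0∞}
    (hρ : ∀ g, (∀ Q ∈ 𝒯, (Q.side : ℝ≥0∞) ^ ((n : ℝ) - d) * luxemburg (complementary Φ) Q g
      ≤ (F : Set (DyadicCube n)).indicator (fun Q => (b Q : ℝ≥0∞)) Q) → ρ g ≤ 1) :
    ∑ Q ∈ F, (Q.side : ℝ≥0∞) ^ d * (b Q * l Q) ≤ associateNorm ρ f := by
  classical
  have hdual : ∀ Q, ∃ g : (Fin n → ℝ) → ℝ, Q ∈ F → AEMeasurable g ∧
      luxemburg (complementary Φ) Q g ≤ 1 ∧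
      l Q * volume Q.toSet ≤ ∫⁻ x in Q.toSet, ‖f x * g x‖ₑ := by
    intro Q
    by_cases hQ : Q ∈ F
    · obtain ⟨g, hg⟩ := exists_dual_of_lt_luxemburg hΦ hΔ hf (hl Q hQ)
      exact ⟨g, fun _ => hg⟩
    · exact ⟨0, fun h => absurd h hQ⟩
  -- The power `d - n` in `c` cancels the Morrey weight, so `c Q * u Q` has weighted average at most
  -- `b Q` on `Q`.
  choose u hu using hdual
  set c : DyadicCube n → ℝ≥0 := fun Q => b Q * Q.side ^ (d - n) with hc
  have hcb : ∀ Q : DyadicCube n, (Q.side : ℝ≥0∞) ^ ((n : ℝ) - d) * c Q = b Q := by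
    intro Q
    have : (Q.side : ℝ≥0∞) ^ ((n : ℝ) - d) * (Q.side : ℝ≥0∞) ^ (d - n) = 1 := by
      rw [← side_rpow_add]; simp
    simp only [hc, ENNReal.coe_mul]
    rw [ENNReal.coe_rpow_of_ne_zero Q.side_pos.ne', mul_left_comm, this, mul_one]
  set g : (Fin n → ℝ) → ℝ := fun x =>
    ∑ Q ∈ F, Q.toSet.indicator (fun x => (c Q : ℝ) * u Q x) x with hg
  have hgF : ∀ Q ∈ F, ∀ x ∈ Q.toSet, g x = c Q * u Q x := by
    intro Q hQ x hx
    simp only [hg]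
    rw [Finset.sum_eq_single Q]
    · rw [Set.indicator_of_mem hx]
    · intro Q' hQ' hne
      exact Set.indicator_of_notMem
        (fun hx' => hne (h𝒯.eq_of_mem (hF Q' hQ') (hF Q hQ) hx' hx)) _
    · exact fun h => absurd hQ h
  have hg0 : ∀ Q ∈ 𝒯, Q ∉ F → ∀ x ∈ Q.toSet, g x = 0 := by
    intro Q hQ hQF x hx
    refine Finset.sum_eq_zero fun Q' hQ' => Set.indicator_of_notMem (fun hx' => hQF ?_) _
    rwa [← h𝒯.eq_of_mem (hF Q' hQ') hQ hx' hx]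
  have hgm : AEMeasurable g :=
    Finset.aemeasurable_fun_sum F fun Q hQ =>
      ((hu Q hQ).1.const_mul _).indicator Q.measurableSet_toSet
  have hρg : ρ g ≤ 1 := by
    refine hρ g fun Q hQ => ?_
    by_cases hQF : Q ∈ F
    · rw [Set.indicator_of_mem (by simpa using hQF), luxemburg_congr (hgF Q hQF), ← hcb]
      gcongr
      refine (luxemburg_const_mul_le (complementary_zero Φ) (c Q)).trans ?_
      exact mul_le_of_le_one_right zero_le (hu Q hQF).2.1
    · rw [luxemburg_eq_zero (complementary_zero Φ) (hg0 Q hQ hQF), mul_zero]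
      exact zero_le
  have hdisj : Set.PairwiseDisjoint (F : Set (DyadicCube n)) DyadicCube.toSet := by
    intro Q hQ Q' hQ' hne
    exact Set.disjoint_left.2 fun x hx hx' =>
      hne (h𝒯.eq_of_mem (hF Q hQ) (hF Q' hQ') hx hx')
  calc ∑ Q ∈ F, (Q.side : ℝ≥0∞) ^ d * (b Q * l Q)
      ≤ ∑ Q ∈ F, ∫⁻ x in Q.toSet, ‖f x * g x‖ₑ := by
        refine Finset.sum_le_sum fun Q hQ => ?_
        calc (Q.side : ℝ≥0∞) ^ d * (b Q * l Q)
            = c Q * (l Q * volume Q.toSet) := by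
              rw [← hcb, volume_toSet, show (n : ℝ) = d + (n - d) by ring, side_rpow_add,
                show d + ((n : ℝ) - d) - d = n - d by ring]
              ring
          _ ≤ c Q * ∫⁻ x in Q.toSet, ‖f x * u Q x‖ₑ := by gcongr; exact (hu Q hQ).2.2
          _ = ∫⁻ x in Q.toSet, c Q * ‖f x * u Q x‖ₑ :=
              (lintegral_const_mul' _ _ ENNReal.coe_ne_top).symm
          _ = _ := by
              refine setLIntegral_congr_fun Q.measurableSet_toSet fun x hx => ?_
              simp only [hgF Q hQ x hx, enorm_mul]
              rw [show ‖(c Q : ℝ)‖ₑ = c Q by rw [enorm_eq_nnnorm, NNReal.nnnorm_eq]]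
              ring
    _ = ∫⁻ x in ⋃ Q ∈ F, Q.toSet, ‖f x * g x‖ₑ :=
        (lintegral_biUnion_finset hdisj (fun Q _ => Q.measurableSet_toSet) _).symm
    _ ≤ ∫⁻ x, ‖f x * g x‖ₑ := setLIntegral_le_lintegral _ _
    _ ≤ _ := le_iSup_of_le g (by rw [iSup_pos hgm, iSup_pos hρg])

/-- Finite `ℓ^p`–`ℓ^q` duality for `ℓ(Q)^(d/p) l_Q` gives extremal weights `w`. With `b_Q =
ℓ(Q)^(-d/q) w_Q` one gets `∑ ℓ(Q)^d b_Q^q = ∑ w_Q^q ≤ 1`, which bounds the tiling Morrey norm. For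
`q = ∞` take `b = 1`. -/
lemma sum_rpow_le_associateNorm {d : ℝ} {p q : ℝ≥0∞}
    (hp_top : p ≠ ∞) (hpq : p.HolderConjugate q) {Φ : ℝ≥0 → ℝ≥0∞} (hΦ : IsYoung Φ)
    (hΔ : Delta2 Φ) {𝒯 : Set (DyadicCube n)} (h𝒯 : IsTiling 𝒯) {f : (Fin n → ℝ) → ℝ}
    (hf : AEMeasurable f) {F : Finset (DyadicCube n)} (hF : ∀ Q ∈ F, Q ∈ 𝒯)
    {l : DyadicCube n → ℝ≥0} (hl : ∀ Q ∈ F, l Q = 0 ∨ (l Q : ℝ≥0∞) < luxemburg Φ Q f) :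
    ∑ Q ∈ F, (Q.side : ℝ≥0∞) ^ d * (l Q : ℝ≥0∞) ^ p.toReal
      ≤ associateNorm (tilingMorreyNorm d q (complementary Φ) 𝒯) f ^ p.toReal := by
  rcases eq_or_ne q ∞ with hq | hq
  · have hp1 : p = 1 := (ENNReal.HolderConjugate.eq_top_iff_eq_one q p).1 hq
    have := sum_le_associateNorm (d := d) hΦ hΔ h𝒯 hf hF (b := fun _ => 1) hl
      (ρ := tilingMorreyNorm d q (complementary Φ) 𝒯) (fun g hg => by
        rw [tilingMorreyNorm, if_pos hq]
        refine choquetNorm_top_le_one fun x => ?_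
        obtain ⟨Q, ⟨hQ, hx⟩, -⟩ := h𝒯 x
        rw [tileSum_apply h𝒯 _ hQ hx]
        exact (hg Q hQ).trans ((Set.indicator_le_self _ _ _).trans (by simp)))
    simpa [hp1] using this
  · have hpq' : p.toReal.HolderConjugate q.toReal :=
      ENNReal.HolderConjugate.toReal_of_ne_top hp_top hq
    set P := p.toReal
    set R := q.toReal
    have hP := hpq'.pos
    have hR := hpq'.symm.pos
    obtain ⟨w, hw, hsum⟩ := (NNReal.isGreatest_Lp F (fun Q => Q.side ^ (d / P) * l Q) hpq').1
    rw [Set.mem_ofPred_eq] at hw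
    change ∑ Q ∈ F, (Q.side ^ (d / P) * l Q) * w Q = _ at hsum
    have hside : ∀ (Q : DyadicCube n) (r : ℝ), ((Q.side ^ r : ℝ≥0) : ℝ≥0∞) = (Q.side : ℝ≥0∞) ^ r :=
      fun Q r => ENNReal.coe_rpow_of_ne_zero Q.side_pos.ne' r
    have key := sum_le_associateNorm (d := d) hΦ hΔ h𝒯 hf hF
      (b := fun Q => Q.side ^ (-(d / R)) * w Q) hl
      (ρ := tilingMorreyNorm d q (complementary Φ) 𝒯) (fun g hg => by
        rw [tilingMorreyNorm, if_neg hq, choquetNorm_one, ENNReal.rpow_inv_le_iff hR,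
          ENNReal.one_rpow]
        refine (choquetIntegral_tileSum_le d h𝒯 _).trans ?_
        rw [tsum_subtype 𝒯 (fun Q => (Q.side : ℝ≥0∞) ^ d *
          ((Q.side : ℝ≥0∞) ^ ((n : ℝ) - d) * luxemburg (complementary Φ) Q g) ^ R)]
        calc _ ≤ ∑' Q, (F : Set (DyadicCube n)).indicator
              (fun Q => ((w Q ^ R : ℝ≥0) : ℝ≥0∞)) Q := by
              refine ENNReal.tsum_le_tsum fun Q => ?_
              by_cases hQ : Q ∈ 𝒯
              swap
              · simp [hQ]
              rw [Set.indicator_of_mem hQ]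
              have hle := hg Q hQ
              by_cases hQF : Q ∈ (F : Set (DyadicCube n))
              · rw [Set.indicator_of_mem hQF] at hle ⊢
                calc _ ≤ (Q.side : ℝ≥0∞) ^ d * ((Q.side ^ (-(d / R)) * w Q : ℝ≥0) : ℝ≥0∞) ^ R := by
                      gcongr
                  _ = _ := by
                      rw [ENNReal.coe_mul, ENNReal.mul_rpow_of_nonneg _ _ hR.le, ← mul_assoc,
                        hside, ← ENNReal.rpow_mul, ← side_rpow_add,
                        show d + -(d / R) * R = 0 by field_simp; ring,
                        ENNReal.rpow_zero, one_mul, ENNReal.coe_rpow_of_nonneg _ hR.le]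
              · rw [Set.indicator_of_notMem hQF, nonpos_iff_eq_zero] at hle
                rw [hle, ENNReal.zero_rpow_of_pos hR, mul_zero]
                exact zero_le
          _ = ∑ Q ∈ F, ((w Q ^ R : ℝ≥0) : ℝ≥0∞) := by
              rw [← tsum_subtype, Finset.tsum_subtype' F (fun Q => ((w Q ^ R : ℝ≥0) : ℝ≥0∞))]
          _ ≤ 1 := by exact_mod_cast hw)
    have hlhs : ∑ Q ∈ F, (Q.side : ℝ≥0∞) ^ d * (((Q.side ^ (-(d / R)) * w Q : ℝ≥0) : ℝ≥0∞) * l Q)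
        = ((∑ Q ∈ F, (Q.side ^ (d / P) * l Q) * w Q : ℝ≥0) : ℝ≥0∞) := by
      rw [ENNReal.ofNNReal_finsetSum]
      refine Finset.sum_congr rfl fun Q _ => ?_
      have hexp : d / P = d + -(d / R) := by
        have := hpq'.inv_add_inv_eq_one
        rw [div_eq_mul_inv, div_eq_mul_inv, eq_sub_of_add_eq this]
        ring
      rw [hexp]
      push_cast
      rw [hside, hside, side_rpow_add]
      ring
    rw [hlhs, hsum, ENNReal.coe_rpow_of_nonneg _ (by positivity), one_div,
      ENNReal.rpow_inv_le_iff hP] at key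
    refine le_trans (le_of_eq ?_) key
    rw [ENNReal.ofNNReal_finsetSum]
    refine Finset.sum_congr rfl fun Q _ => ?_
    rw [ENNReal.coe_rpow_of_nonneg _ hP.le, ENNReal.coe_mul, ENNReal.mul_rpow_of_nonneg _ _ hP.le,
      hside, ← ENNReal.rpow_mul, div_mul_cancel₀ _ hP.ne']

lemma blockNorm_le_associateNorm {d : ℝ} {p q : ℝ≥0∞} (hp : 1 ≤ p)
    (hp_top : p ≠ ∞) (hpq : p.HolderConjugate q) {Φ : ℝ≥0 → ℝ≥0∞} (hΦ : IsYoung Φ)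
    (hΔ : Delta2 Φ) {𝒯 : Set (DyadicCube n)} (h𝒯 : IsTiling 𝒯) {f : (Fin n → ℝ) → ℝ}
    (hf : AEMeasurable f) :
    blockNorm d p Φ 𝒯 f
      ≤ 2 * associateNorm (tilingMorreyNorm d q (complementary Φ) 𝒯) f := by
  have hp0 : 0 < p.toReal := ENNReal.toReal_pos (zero_lt_one.trans_le hp).ne' hp_top
  set S := associateNorm (tilingMorreyNorm d q (complementary Φ) 𝒯) f with hS
  set P := p.toReal
  set a : DyadicCube n → ℝ≥0∞ := fun Q => luxemburg Φ Q f with ha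
  have hfinite : ∀ F : Finset (DyadicCube n), (∀ Q ∈ F, Q ∈ 𝒯) →
      ∑ Q ∈ F, (Q.side : ℝ≥0∞) ^ d * (a Q / 2) ^ P ≤ S ^ P := by
    intro F hF
    -- Local extremals exist only strictly below the Luxemburg average. Halving provides the room
    -- and costs the factor `2`; truncating at `m` covers infinite averages.
    have hcoe : ∀ (m : ℕ) Q, ((min (a Q / 2) m).toNNReal : ℝ≥0∞) = min (a Q / 2) m :=
      fun m Q => ENNReal.coe_toNNReal
        (ne_top_of_le_ne_top (ENNReal.natCast_ne_top m) (min_le_right _ _))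
    have hm : ∀ m : ℕ, ∑ Q ∈ F, (Q.side : ℝ≥0∞) ^ d * (min (a Q / 2) m) ^ P ≤ S ^ P := by
      intro m
      have := sum_rpow_le_associateNorm (d := d) hp_top hpq hΦ hΔ h𝒯 hf hF
        (l := fun Q => (min (a Q / 2) m).toNNReal) (fun Q _ => by
          rw [hcoe]
          rcases eq_or_ne (a Q) 0 with h0 | h0
          · left; simp [h0]
          · right
            change _ < a Q
            rcases eq_or_ne (a Q) ∞ with htop | htop
            · rw [htop]
              exact (min_le_right _ _).trans_lt (ENNReal.natCast_ne_top m).lt_top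
            · exact (min_le_left _ _).trans_lt (ENNReal.half_lt_self h0 htop))
      simpa only [hcoe] using this
    refine le_of_tendsto' (f := fun m : ℕ =>
      ∑ Q ∈ F, (Q.side : ℝ≥0∞) ^ d * (min (a Q / 2) m) ^ P) (x := atTop) ?_ hm
    refine tendsto_finsetSum F fun Q _ => ?_
    refine ENNReal.Tendsto.const_mul ?_ (Or.inr (Q.side_rpow_ne_top d))
    refine (ENNReal.continuous_rpow_const.tendsto _).comp ?_
    have : Tendsto (fun m : ℕ => min (a Q / 2) (m : ℝ≥0∞)) atTop (𝓝 (min (a Q / 2) ∞)) :=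
      tendsto_const_nhds.min ENNReal.tendsto_nat_nhds_top
    simpa using this
  have htsum : ∑' Q : 𝒯, ((Q : DyadicCube n).side : ℝ≥0∞) ^ d * (a Q / 2) ^ P ≤ S ^ P := by
    rw [ENNReal.tsum_eq_iSup_sum]
    refine iSup_le fun F => ?_
    have := hfinite (F.map (Function.Embedding.subtype _)) fun Q hQ => by
      obtain ⟨Q', -, rfl⟩ := Finset.mem_map.1 hQ
      exact Q'.2
    simpa using this
  rw [blockNorm_eq, ENNReal.rpow_inv_le_iff hp0]
  calc choquetIntegral d (tileSum 𝒯 fun Q => a Q ^ P)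
      ≤ ∑' Q : 𝒯, ((Q : DyadicCube n).side : ℝ≥0∞) ^ d * a Q ^ P :=
        choquetIntegral_tileSum_le d h𝒯 _
    _ = 2 ^ P * ∑' Q : 𝒯, ((Q : DyadicCube n).side : ℝ≥0∞) ^ d * (a Q / 2) ^ P := by
        rw [← ENNReal.tsum_mul_left]
        refine tsum_congr fun Q => ?_
        rw [mul_left_comm, ← ENNReal.mul_rpow_of_nonneg _ _ hp0.le,
          ENNReal.mul_div_cancel two_ne_zero ENNReal.ofNat_ne_top]
    _ ≤ 2 ^ P * S ^ P := by gcongr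
    _ = _ := (ENNReal.mul_rpow_of_nonneg _ _ hp0.le).symm

end ChoquetMorrey

end

theorem theorem3p1 (n : ℕ) (d : ℝ) (hd : 0 < d) (hdn : d < n)
    (p q : ℝ≥0∞) (hp : 1 ≤ p) (hp_top : p ≠ ∞) (hpq : p.HolderConjugate q)
    (Φ : ℝ≥0 → ℝ≥0∞) (hΦ : ChoquetMorrey.IsYoung Φ) (hΔ : ChoquetMorrey.Delta2 Φ) :
    ∃ C : ℝ≥0, ∀ 𝒯 : Set (ChoquetMorrey.DyadicCube n), ChoquetMorrey.IsTiling 𝒯 →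
      ∀ f : (Fin n → ℝ) → ℝ, AEMeasurable f volume →
        ChoquetMorrey.associateNorm
            (ChoquetMorrey.morreyNorm d q (ChoquetMorrey.complementary Φ)) f
          ≤ C * ChoquetMorrey.blockNorm d p Φ 𝒯 f ∧
        ChoquetMorrey.blockNorm d p Φ 𝒯 f
          ≤ C * ChoquetMorrey.associateNorm
              (ChoquetMorrey.tilingMorreyNorm d q (ChoquetMorrey.complementary Φ) 𝒯) f := by
  refine ⟨48, fun 𝒯 h𝒯 f hf => ⟨?_, ?_⟩⟩
  · exact iSup_le fun g => iSup₂_le fun hg hg1 =>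
      ChoquetMorrey.lintegral_mul_le_blockNorm hd hdn hp hp_top hpq hΦ hΔ h𝒯 hf hg hg1
  · refine (ChoquetMorrey.blockNorm_le_associateNorm hp hp_top hpq hΦ hΔ h𝒯 hf).trans ?_
    gcongr
    norm_num
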